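/- **Theorem B.** *Conventions.* Machines are multi-tape Turing machines with a read-only input tape, deterministic or nondeterministic; a computation may halt with answer "yes", "no", or without an answer. The decision on an input is "yes" if some computation halts with "yes", and "no" if all computations terminate and all answer "no". A complexity class $\mathcal C$ is given by a mode (deterministic or nondeterministic) and, for time or space or both, a collection of positive nondecreasing functions $f:\mathbb N\to\mathbb N$ that contains with $f$ also $n\mapsto Cf(Cn+C)+C$ for every integer $C\ge 1$. A language $\mathcal D\subseteq X^*$ is in $\mathcal C$ if some machine of the given mode terminates with the correct decision on all inputs $w$, all its computations using, of each controlled resource, at most $f(|w|)$ units for some $f$ in the corresponding collection. A set $S\subseteq X^*$ is *generic* if the proportion $\rho_n(S)$ of words in $S$ among all words of length at most $n$ tends to $1$, and *strongly generic* if moreover $1-\rho_n(S)\le c\,\sigma^n$ for all $n\ge 1$, with some $c>0$ and $0\le\sigma<1$. The language $\mathcal D$ is *(strongly) generically in $\mathcal C$* if there are a (strongly) generic set $S$ and a machine of the given mode, all of whose definite decisions are correct, which on all inputs $w\in S$ terminates with a decision within bounds of $\mathcal C$ as above. For a group $G$, a subgroup $H$ and a finite generating family $A=(a_1,\dots,a_k)$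 of $G$, the membership problem for $H$ with respect to $A$ is the set of words over the $2k$ letters $A\cup A^{-1}$ that represent elements of $H$. The membership problem for $H$ in $G$ is in $\mathcal C$, or is (strongly) generically in $\mathcal C$, if this holds with respect to every finite generating family $A$ of $G$. The Schreier coset graph $\Gamma(G,H,A)$ has the cosets $Hg$ as vertices and an edge from $Hg$ to $Hgx$ for every letter $x\in A\cup A^{-1}$; it is *amenable* if $\frac1{2k}\limsup_{n\to\infty} b_n^{1/n}=1$, where $b_n$ is the number of paths of length $n$ from $H$ to $H$ in it. *Statement.* Let $G$ be a finitely generated group, let $H\le G_1\le G$ with $[G:G_1]<\infty$, and let $\phi:G_1\to\overline G$ be an epimorphism such that $\phi(H)$ is contained in a subgroup $\overline K\le\overline G$ of infinite index. Let $\mathcal C$ be a complexity class such that the membership problem for $\overline K$ in $\overline G$ is in $\mathcal C$. Then the membership problem for $H$ in $G$ is generically in $\mathcal C$. Moreover, if $\Gamma(\overline G,\overline K,B)$ is non-amenable for some finite generating family $B$ of $\overline G$, then it is so for every such $B$, and the membership problem for $H$ in $G$ is strongly generically in $\mathcal C$. -/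

import Mathlib

open Filter Topology

namespace GenericCase

/-! ### Multi-tape Turing machines -/

/-- What the input head can scan: the left end marker, a letter of the input word, or the right
end marker. -/
inductive InputSymbol (X : Type) : Type
  | left : InputSymbol X
  | letter (x : X) : InputSymbol X
  | right : InputSymbol X

/-- Head movements. -/
inductive Move : Type
  | left : Move
  | stay : Move
  | right : Move

/-- One instruction of a machine with state set `Q`, tape alphabet `Γ` and `k` work tapes. -/
structure Action (Q Γ : Type) (k : ℕ) : Type where
  next : Q
  inputMove : Move
  write : Fin k → Γ
  move : Fin k → Move

/-- A (possibly nondeterministic) Turing machine over the input alphabet `X`, with a two-way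
read-only input tape and `k` read-write work tapes, each infinite to the right.
A configuration in which no instruction applies is halting; the answer is then read off the
state: yes (`some true`), no (`some false`), or no definite decision (`none`). -/
structure Machine (X : Type) : Type 1 where
  Q : Type
  finiteQ : Finite Q
  Γ : Type
  finiteΓ : Finite Γ
  k : ℕ
  start : Q
  blank : Γ
  trans : Q → InputSymbol X → (Fin k → Γ) → Set (Action Q Γ k)
  answer : Q → Option Bool

namespace Machine

variable {X : Type}

/-- Configurations. Position `0` of the input tape is the left end marker, positions
`1, …, |w|` hold the letters of the input word `w`, position `|w| + 1` is the right end marker.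
`used i` is the number of cells of the `i`-th work tape visited so far. -/
structure Config (M : Machine X) : Type where
  state : M.Q
  inputPos : ℕ
  tape : Fin M.k → ℕ → M.Γ
  pos : Fin M.k → ℕ
  used : Fin M.k → ℕ

/-- The symbol at position `p` of the input tape. -/
def inputAt (w : List X) : ℕ → InputSymbol X
  | 0 => InputSymbol.left
  | p + 1 => match w[p]? with
    | some x => InputSymbol.letter x
    | none => InputSymbol.right

/-- The new position of a work-tape head (at the left end of the tape it cannot move left). -/
def moveHead : Move → ℕ → ℕ
  | Move.left, p => p - 1
  | Move.stay, p => p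
  | Move.right, p => p + 1

/-- The new position of the input head, which cannot leave `0, …, |w| + 1`. -/
def moveInput (w : List X) (d : Move) (p : ℕ) : ℕ :=
  min (moveHead d p) (w.length + 1)

/-- The initial configuration: all heads at the left ends, work tapes blank. -/
def init (M : Machine X) : M.Config where
  state := M.start
  inputPos := 0
  tape := fun _ _ => M.blank
  pos := fun _ => 0
  used := fun _ => 1

/-- The instructions that apply in the configuration `c` on input `w`. -/
def enabled (M : Machine X) (w : List X) (c : M.Config) : Set (Action M.Q M.Γ M.k) :=
  M.trans c.state (inputAt w c.inputPos) (fun i => c.tape i (c.pos i))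

/-- The configuration that results from executing an instruction. -/
def exec (M : Machine X) (w : List X) (c : M.Config) (a : Action M.Q M.Γ M.k) : M.Config where
  state := a.next
  inputPos := moveInput w a.inputMove c.inputPos
  tape := fun i => Function.update (c.tape i) (c.pos i) (a.write i)
  pos := fun i => moveHead (a.move i) (c.pos i)
  used := fun i => max (c.used i) (moveHead (a.move i) (c.pos i) + 1)

/-- `M.ReachIn w n c`: some computation of `M` on input `w` is in configuration `c` after exactly
`n` steps. -/
inductive ReachIn (M : Machine X) (w : List X) : ℕ → M.Config → Prop
  | init : ReachIn M w 0 M.init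
  | step {n : ℕ} {c : M.Config} {a : Action M.Q M.Γ M.k} :
      ReachIn M w n c → a ∈ M.enabled w c → ReachIn M w (n + 1) (M.exec w c a)

/-- `c` is a halting configuration of some computation on input `w`. -/
def HaltsIn (M : Machine X) (w : List X) (c : M.Config) : Prop :=
  (∃ n, M.ReachIn w n c) ∧ M.enabled w c = ∅

/-- Every computation on input `w` makes at most `t` steps. -/
def TimeBound (M : Machine X) (w : List X) (t : ℕ) : Prop :=
  ∀ n c, M.ReachIn w n c → n ≤ t

/-- Every computation on input `w` visits at most `s` cells of the work tapes altogether. -/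
def SpaceBound (M : Machine X) (w : List X) (s : ℕ) : Prop :=
  ∀ n c, M.ReachIn w n c → ∑ i, c.used i ≤ s

/-- All computations on input `w` terminate. -/
def Terminates (M : Machine X) (w : List X) : Prop :=
  ∃ t, M.TimeBound w t

/-- The decision "yes": some computation on input `w` halts with answer yes. -/
def Accepts (M : Machine X) (w : List X) : Prop :=
  ∃ c, M.HaltsIn w c ∧ M.answer c.state = some true

/-- The decision "no": all computations on input `w` terminate, and all with answer no. -/
def Rejects (M : Machine X) (w : List X) : Prop :=
  M.Terminates w ∧ ∀ c, M.HaltsIn w c → M.answer c.state = some false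

/-- In every situation at most one instruction applies. -/
def Deterministic (M : Machine X) : Prop :=
  ∀ q x g, (M.trans q x g).Subsingleton

end Machine

/-! ### Complexity classes -/

/-- Modes of computation. -/
inductive Mode : Type
  | deterministic : Mode
  | nondeterministic : Mode

/-- A family of bounds for one resource: positive nondecreasing functions, closed under
`f ↦ C f(Cn + C) + C` for all integers `C ≥ 1`. (No constructibility of the bounds is demanded,
so that the families of proper complexity functions with this closure property are included.) -/
structure IsBoundFamily (F : Set (ℕ → ℕ)) : Prop where
  mono : ∀ f ∈ F, Monotone f
  pos : ∀ f ∈ F, ∀ n, 0 < f n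
  closed : ∀ f ∈ F, ∀ C : ℕ, 1 ≤ C → (fun n => C * f (C * n + C) + C) ∈ F

/-- A complexity class: a mode of computation, and a family of bounds for each controlled
resource (`none` means that the resource is not controlled). -/
structure ComplexityClass : Type where
  mode : Mode
  time : Option (Set (ℕ → ℕ))
  space : Option (Set (ℕ → ℕ))
  controlled : time.isSome ∨ space.isSome
  time_bounds : ∀ F ∈ time, IsBoundFamily F
  space_bounds : ∀ F ∈ space, IsBoundFamily F

namespace ComplexityClass

variable {X : Type}

/-- `M` is a machine of the mode of `C`. -/
def AllowsMode (C : ComplexityClass) (M : Machine X) : Prop :=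
  C.mode = Mode.deterministic → M.Deterministic

/-- On every input from `S` the machine `M` terminates with a definite decision within the
complexity bound `C`. -/
def DecidesOn (C : ComplexityClass) (M : Machine X) (S : Set (List X)) : Prop :=
  (∀ w ∈ S, M.Terminates w ∧ (M.Accepts w ∨ M.Rejects w)) ∧
  (∀ F ∈ C.time, ∃ f ∈ F, ∀ w ∈ S, M.TimeBound w (f w.length)) ∧
  (∀ F ∈ C.space, ∃ f ∈ F, ∀ w ∈ S, M.SpaceBound w (f w.length))

end ComplexityClass

/-- `M` is a correct partial algorithm for `D`: every definite decision it reaches is correct. -/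
def CorrectFor {X : Type} (M : Machine X) (D : Set (List X)) : Prop :=
  ∀ w, (M.Accepts w → w ∈ D) ∧ (M.Rejects w → w ∉ D)

/-- The language `D` is in the complexity class `C`. -/
def InClass {X : Type} (C : ComplexityClass) (D : Set (List X)) : Prop :=
  ∃ M : Machine X, C.AllowsMode M ∧ CorrectFor M D ∧ C.DecidesOn M Set.univ

/-! ### Asymptotic density and generic-case complexity -/

/-- The proportion of words of length at most `n` that belong to `S`. -/
noncomputable def density {X : Type} (S : Set (List X)) (n : ℕ) : ℝ :=
  ((S ∩ {w | w.length ≤ n}).ncard : ℝ) / (({w | w.length ≤ n} : Set (List X)).ncard : ℝ)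

/-- Generic sets of words. -/
def Generic {X : Type} (S : Set (List X)) : Prop :=
  Tendsto (density S) atTop (𝓝 1)

/-- Strongly generic sets of words: the density tends to `1` exponentially fast. -/
def StronglyGeneric {X : Type} (S : Set (List X)) : Prop :=
  Generic S ∧ ∃ σ C : ℝ, 0 ≤ σ ∧ σ < 1 ∧ 0 < C ∧ ∀ n : ℕ, 1 ≤ n → 1 - density S n ≤ C * σ ^ n

/-- `D` is in `Gen(C)`. -/
def InGen {X : Type} (C : ComplexityClass) (D : Set (List X)) : Prop :=
  ∃ M : Machine X, C.AllowsMode M ∧ CorrectFor M D ∧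
    ∃ S : Set (List X), Generic S ∧ C.DecidesOn M S

/-- `D` is in `SGen(C)`. -/
def InSGen {X : Type} (C : ComplexityClass) (D : Set (List X)) : Prop :=
  ∃ M : Machine X, C.AllowsMode M ∧ CorrectFor M D ∧
    ∃ S : Set (List X), StronglyGeneric S ∧ C.DecidesOn M S

/-! ### The membership problem -/

section Groups

variable {G : Type*} [Group G] {k : ℕ}

/-- The family `a` generates the group `G`. -/
def Generates (a : Fin k → G) : Prop :=
  Subgroup.closure (Set.range a) = ⊤

/-- The element of `G` represented by a letter of `A ∪ A⁻¹`; the letters are `(i, true)` for `aᵢ`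
and `(i, false)` for `aᵢ⁻¹`. -/
def letterVal (a : Fin k → G) (x : Fin k × Bool) : G :=
  if x.2 then a x.1 else (a x.1)⁻¹

/-- The element of `G` represented by a word. -/
def wordVal (a : Fin k → G) (w : List (Fin k × Bool)) : G :=
  (w.map (letterVal a)).prod

/-- The membership problem for `H` with respect to the generators `a`. -/
def MP (H : Subgroup G) (a : Fin k → G) : Set (List (Fin k × Bool)) :=
  {w | wordVal a w ∈ H}

/-- The membership problem for `H` in `G` is in the class `C`. -/
def MembershipIn (C : ComplexityClass) (H : Subgroup G) : Prop :=
  ∀ (k : ℕ) (a : Fin k → G), Generates a → InClass C (MP H a)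

/-- The membership problem for `H` in `G` has generic-case complexity in `C`. -/
def MembershipGenericallyIn (C : ComplexityClass) (H : Subgroup G) : Prop :=
  ∀ (k : ℕ) (a : Fin k → G), Generates a → InGen C (MP H a)

/-- The membership problem for `H` in `G` has generic-case complexity strongly in `C`. -/
def MembershipStronglyGenericallyIn (C : ComplexityClass) (H : Subgroup G) : Prop :=
  ∀ (k : ℕ) (a : Fin k → G), Generates a → InSGen C (MP H a)

/-! ### Schreier coset graphs -/

/-- The vertices of the Schreier coset graph: the right cosets `Hg`. -/
abbrev Coset (H : Subgroup G) : Type _ := Quotient (QuotientGroup.rightRel H)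

/-- Right multiplication `Hg ↦ Hgx` of cosets. -/
def Coset.mulRight {H : Subgroup G} (v : Coset H) (x : G) : Coset H :=
  Quotient.map' (s₂ := QuotientGroup.rightRel H) (fun g => g * x) (by
    intro g g' h
    rw [QuotientGroup.rightRel_apply] at h ⊢
    simpa [mul_assoc] using h) v

/-- The Schreier coset graph `Γ(G, H, a)` has exactly one edge with origin `v` for each letter `x`,
and it ends at `vx`. So a path with origin `v` is given by the sequence of labels of its
edges; this is the terminal vertex of that path. -/
def pathEnd (H : Subgroup G) (a : Fin k → G) (v : Coset H) (p : List (Fin k × Bool)) : Coset H :=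
  p.foldl (fun u x => u.mulRight (letterVal a x)) v

/-- The number of paths of length `n` in `Γ(G, H, a)` from the base vertex `H1` to itself. -/
noncomputable def closedPaths (H : Subgroup G) (a : Fin k → G) (n : ℕ) : ℕ :=
  {p : List (Fin k × Bool) | p.length = n ∧
    pathEnd H a (Quotient.mk'' 1) p = (Quotient.mk'' 1 : Coset H)}.ncard

/-- The spectral radius `ν = (1/d) limsup (bₙ)^(1/n)` of the `d`-regular graph `Γ(G, H, a)`, where
`d = 2k` and `bₙ` is the number of closed paths of length `n` at the base vertex. -/
noncomputable def spectralRadius (H : Subgroup G) (a : Fin k → G) : ℝ :=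
  limsup (fun n : ℕ => (closedPaths H a n : ℝ) ^ (1 / (n : ℝ))) atTop / (2 * k)

/-- The Schreier coset graph `Γ(G, H, a)` is amenable. -/
def SchreierAmenable (H : Subgroup G) (a : Fin k → G) : Prop :=
  spectralRadius H a = 1

end Groups

end GenericCase

/-! Write `L` for `preimage φ K`, a subgroup of `G` that contains `H` and has infinite index. The
partial algorithm only ever says "no". Schreier rewriting along a transversal `r` of `G₁` turns `w`
into a word of the same length over generators of `Gbar`, whose value is `φ (w · r s)` with `s =
w⁻¹G₁`. A machine for `K` is run on that word. If `w ∈ H`, then `r s = 1` and the value lies in `K`,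
so a rejection is always correct; an acceptance says nothing about `H` and is withheld. Rewriting is
done by an automaton with bijective transitions, so a two-way head can carry the current state along
and resource bounds transfer unchanged (`InClass.exists_pullback`, `exists_schreier_transducer`).

Undecided words satisfy `w · r s ∈ L`, that is, they carry one of finitely many points `r s L` of `G
⧸ L` to the base point (`exists_partial_algorithm`). It remains to bound the probability that the
simple random walk on `G ⧸ L`, with symmetric transition operator `P`, goes from one given point to
another.

Since `G ⧸ L` is infinite and transitive, this probability tends to 0
(`tendsto_norm_walkOp_pow_single`): the decreasing sequence `‖Pⁿδ‖²` converges, so `Pⁿδ` becomes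
almost invariant under products of two letters, and a positive limit would put too much mass on
infinitely many points.

For exponential decay, non-amenability is translated into `HasGap`: some finite family displaces
every function by a fixed proportion of its norm. Decay of return probabilities yields a gap by
log-convexity of `‖Pⁿf‖²` (`hasGap_of_decay`), and a gap yields decay through a bound on the norm of
`P` (`HasGap.exists_decay`). Gaps pass to every finite generating family (`HasGap.of_generates`) and
from `Gbar ⧸ K` to `G ⧸ L`, which is a finite union of copies of it (`HasGap.preimage`). -/

namespace GenericCase

/-! ### Reversible letter-to-letter transducers -/

/-- A finite automaton over `X` whose transitions can be undone and which outputs one letter of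
`Y` for every letter read. -/
structure Transducer (X Y : Type) : Type 1 where
  S : Type
  finiteS : Finite S
  start : S
  next : S → X → S
  prev : S → X → S
  out : S → X → Y
  prev_next : ∀ s x, prev (next s x) x = s

namespace Transducer

variable {X Y : Type} (T : Transducer X Y)

/-- The state reached from `s` by reading a word. -/
def run (s : T.S) (w : List X) : T.S := w.foldl T.next s

/-- The output produced from the state `s` on a word. -/
def output : T.S → List X → List Y
  | _, [] => []
  | s, x :: w => T.out s x :: output (T.next s x) w

@[simp] lemma length_output (s : T.S) (w : List X) : (T.output s w).length = w.length := by
  induction w generalizing s with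
  | nil => rfl
  | cons x w ih => simp [output, ih]

lemma getElem?_output (s : T.S) (w : List X) (p : ℕ) :
    (T.output s w)[p]? = (w[p]?).map (T.out (T.run s (w.take p))) := by
  induction w generalizing s p with
  | nil => simp [output]
  | cons x w ih =>
    cases p with
    | zero => simp [output, run]
    | succ p => simp [output, ih, run]

/-- The state before the scanned letter, recovered from a stored state `s` that belongs to the
near side of the letter (`b = false`) or to its far side (`b = true`). -/
def before (s : T.S) : Bool → InputSymbol X → T.S
  | true, InputSymbol.letter x => T.prev s x
  | _, _ => s

/-- The symbol of the output word that corresponds to the scanned symbol. -/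
def symbol (s : T.S) : InputSymbol X → InputSymbol Y
  | InputSymbol.left => InputSymbol.left
  | InputSymbol.letter x => InputSymbol.letter (T.out s x)
  | InputSymbol.right => InputSymbol.right

/-- The state to be stored after a move of the input head, where `s` is the state before the
scanned symbol. -/
def update (s : T.S) : InputSymbol X → Move → T.S × Bool
  | _, Move.left => (s, true)
  | _, Move.stay => (s, false)
  | InputSymbol.letter x, Move.right => (T.next s x, false)
  | _, Move.right => (s, false)

end Transducer

/-! ### Running a machine on the output of a transducer. -/

namespace Machine

variable {X Y : Type}

/-- The machine that simulates `M` step by step on the output of the transducer `T`, keeps the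
negative answer and withholds every other answer. -/
def pullback (M : Machine Y) (T : Transducer X Y) : Machine X where
  Q := M.Q × T.S × Bool
  finiteQ := by
    have := M.finiteQ
    have := T.finiteS
    infer_instance
  Γ := M.Γ
  finiteΓ := M.finiteΓ
  k := M.k
  start := (M.start, T.start, false)
  blank := M.blank
  trans := fun q x g =>
    (fun α : Action M.Q M.Γ M.k =>
      (⟨(α.next, T.update (T.before q.2.1 q.2.2 x) x α.inputMove), α.inputMove, α.write, α.move⟩ :
        Action (M.Q × T.S × Bool) M.Γ M.k)) ''
      M.trans q.1 (T.symbol (T.before q.2.1 q.2.2 x) x) g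
  answer := fun q => if M.answer q.1 = some false then some false else none

variable (M : Machine Y) (T : Transducer X Y)

lemma pullback_deterministic (h : M.Deterministic) : (M.pullback T).Deterministic :=
  fun _ _ _ => (h _ _ _).image _

/-- The configuration of `M` simulated by a configuration of `M.pullback T`. -/
def simulated (c : (M.pullback T).Config) : M.Config where
  state := c.state.1
  inputPos := c.inputPos
  tape := c.tape
  pos := c.pos
  used := c.used

/-- The stored transducer state is the right one. -/
def Tracks (w : List X) (c : (M.pullback T).Config) : Prop :=
  c.inputPos ≤ w.length + 1 ∧
    T.before c.state.2.1 c.state.2.2 (inputAt w c.inputPos) =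
      T.run T.start (w.take (c.inputPos - 1))

variable {M T}

lemma symbol_inputAt (w : List X) (p : ℕ) :
    T.symbol (T.run T.start (w.take (p - 1))) (inputAt w p) =
      inputAt (T.output T.start w) p := by
  cases p with
  | zero => rfl
  | succ p =>
    simp only [inputAt, T.getElem?_output, Nat.add_sub_cancel]
    cases w[p]? <;> rfl

/-- A right move across a letter applies `next`. After a left move the stored state sits on the far
side of the newly scanned letter, and `prev` recovers the near side; this is where reversibility is
needed. -/
lemma before_update (w : List X) {p : ℕ} (hp : p ≤ w.length + 1) (d : Move) :
    T.before (T.update (T.run T.start (w.take (p - 1))) (inputAt w p) d).1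
        (T.update (T.run T.start (w.take (p - 1))) (inputAt w p) d).2
        (inputAt w (moveInput w d p)) =
      T.run T.start (w.take (moveInput w d p - 1)) := by
  cases d with
  | stay =>
    have : moveInput w Move.stay p = p := by simp [moveInput, moveHead, hp]
    rw [this]
    cases inputAt w p <;> rfl
  | left =>
    have : moveInput w Move.left p = p - 1 := by simp [moveInput, moveHead]; omega
    rw [this]
    -- By truncated subtraction, positions 0 and 1 both have the empty prefix before them, so the
    -- left marker and the first letter share the start state.
    rcases p with _ | _ | p
    · rfl
    · rfl
    · have hp' : p < w.length := by omega
      have hx : inputAt w (p + 1 + 1 - 1) = InputSymbol.letter w[p] := by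
        simp [inputAt, hp']
      have hu : ∀ s y, T.update s y Move.left = (s, true) := by intro s y; cases y <;> rfl
      rw [hx, hu]
      simp only [Transducer.before, Nat.add_sub_cancel]
      rw [List.take_add_one, List.getElem?_eq_getElem hp']
      simp only [Transducer.run, Option.toList, List.foldl_append, List.foldl_cons,
        List.foldl_nil, T.prev_next]
  | right =>
    have hb : ∀ s y, T.before s false y = s := by intro s y; cases y <;> rfl
    rcases p with _ | p
    · have h1 : moveInput w Move.right 0 = 1 := by simp [moveInput, moveHead]
      rw [h1]
      exact hb _ _
    · rcases Nat.lt_or_ge p w.length with hp' | hp'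
      · have h1 : moveInput w Move.right (p + 1) = p + 2 := by
          simp [moveInput, moveHead]; omega
        have hx : inputAt w (p + 1) = InputSymbol.letter w[p] := by simp [inputAt, hp']
        rw [h1, hx]
        simp only [Transducer.update, hb, Nat.add_sub_cancel]
        rw [show p + 2 - 1 = p + 1 from rfl, List.take_add_one (i := p), List.getElem?_eq_getElem hp']
        simp only [Transducer.run, Option.toList, List.foldl_append, List.foldl_cons,
          List.foldl_nil]
      · have h0 : p = w.length := by omega
        have h1 : moveInput w Move.right (p + 1) = p + 1 := by
          simp [moveInput, moveHead]; omega
        have hx : inputAt w (p + 1) = InputSymbol.right := by simp [inputAt, h0]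
        rw [h1, hx]
        rfl

variable (M T) in
/-- The instruction of `M.pullback T` that simulates an instruction of `M` when the input head
scans `x` and `s` is the state of the transducer before that symbol. -/
def liftAction (s : T.S) (x : InputSymbol X) (α : Action M.Q M.Γ M.k) :
    Action (M.pullback T).Q (M.pullback T).Γ (M.pullback T).k where
  next := (α.next, T.update s x α.inputMove)
  inputMove := α.inputMove
  write := α.write
  move := α.move

lemma pullback_enabled {w : List X} {c : (M.pullback T).Config} (hc : Tracks M T w c) :
    (M.pullback T).enabled w c =
      liftAction M T (T.run T.start (w.take (c.inputPos - 1))) (inputAt w c.inputPos) ''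
        M.enabled (T.output T.start w) (simulated M T c) := by
  have h := symbol_inputAt (T := T) w c.inputPos
  rw [← hc.2] at h
  rw [← hc.2]
  unfold enabled
  rw [← show inputAt (T.output T.start w) c.inputPos = inputAt (T.output T.start w)
    (simulated M T c).inputPos from rfl, ← h]
  rfl

lemma simulated_exec {w : List X} {c : (M.pullback T).Config} (s : T.S) (x : InputSymbol X)
    (α : Action M.Q M.Γ M.k) :
    simulated M T ((M.pullback T).exec w c (liftAction M T s x α)) =
      M.exec (T.output T.start w) (simulated M T c) α := by
  simp only [simulated, exec, moveInput, Transducer.length_output]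
  rfl

lemma tracks_exec {w : List X} {c : (M.pullback T).Config} (hc : Tracks M T w c)
    (α : Action M.Q M.Γ M.k) :
    Tracks M T w ((M.pullback T).exec w c (liftAction M T
      (T.run T.start (w.take (c.inputPos - 1))) (inputAt w c.inputPos) α)) :=
  ⟨min_le_right _ _, before_update w hc.1 _⟩

lemma tracks_init (w : List X) : Tracks M T w (M.pullback T).init :=
  ⟨Nat.zero_le _, rfl⟩

/-- Together with `ReachIn.lift` this is a bisimulation that preserves step counts and work tapes.
Both directions matter, because rejection quantifies over all computations. -/
lemma ReachIn.simulated {w : List X} {n : ℕ} {c : (M.pullback T).Config}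
    (h : (M.pullback T).ReachIn w n c) :
    Tracks M T w c ∧ M.ReachIn (T.output T.start w) n (simulated M T c) := by
  induction h with
  | init => exact ⟨tracks_init w, ReachIn.init⟩
  | step _ ha ih =>
    rw [pullback_enabled ih.1] at ha
    obtain ⟨α, hα, rfl⟩ := ha
    refine ⟨tracks_exec ih.1 α, ?_⟩
    rw [simulated_exec]
    exact ih.2.step hα

lemma ReachIn.lift {w : List X} {n : ℕ} {c : M.Config}
    (h : M.ReachIn (T.output T.start w) n c) :
    ∃ c', (M.pullback T).ReachIn w n c' ∧ Machine.simulated M T c' = c := by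
  induction h with
  | init => exact ⟨_, ReachIn.init, rfl⟩
  | @step n c a _ ha ih =>
    obtain ⟨c', hc', rfl⟩ := ih
    refine ⟨_, ReachIn.step hc' ?_, simulated_exec (T.run T.start (w.take (c'.inputPos - 1)))
      (inputAt w c'.inputPos) a⟩
    rw [pullback_enabled hc'.simulated.1]
    exact ⟨a, ha, rfl⟩

lemma pullback_timeBound_iff {w : List X} {t : ℕ} :
    (M.pullback T).TimeBound w t ↔ M.TimeBound (T.output T.start w) t := by
  constructor
  · intro h n c hc
    obtain ⟨c', hc', -⟩ := hc.lift
    exact h n c' hc'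
  · exact fun h n c hc => h n _ hc.simulated.2

lemma pullback_spaceBound {w : List X} {s : ℕ} (h : M.SpaceBound (T.output T.start w) s) :
    (M.pullback T).SpaceBound w s :=
  fun n _ hc => h n _ hc.simulated.2

lemma HaltsIn.simulated {w : List X} {c : (M.pullback T).Config}
    (h : (M.pullback T).HaltsIn w c) :
    M.HaltsIn (T.output T.start w) (simulated M T c) := by
  obtain ⟨⟨n, hn⟩, h0⟩ := h
  refine ⟨⟨n, hn.simulated.2⟩, ?_⟩
  rw [pullback_enabled hn.simulated.1, Set.image_eq_empty] at h0
  exact h0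

lemma HaltsIn.lift {w : List X} {c : M.Config} (h : M.HaltsIn (T.output T.start w) c) :
    ∃ c', (M.pullback T).HaltsIn w c' ∧ Machine.simulated M T c' = c := by
  obtain ⟨⟨n, hn⟩, h0⟩ := h
  obtain ⟨c', hc', rfl⟩ := hn.lift
  refine ⟨c', ⟨⟨n, hc'⟩, ?_⟩, rfl⟩
  rw [pullback_enabled hc'.simulated.1, h0, Set.image_empty]

lemma pullback_not_accepts (w : List X) : ¬ (M.pullback T).Accepts w := by
  rintro ⟨c, -, h⟩
  simp only [pullback] at h
  split_ifs at h
  simp at h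

lemma pullback_answer_eq_no (c : (M.pullback T).Config) :
    (M.pullback T).answer c.state = some false ↔
      M.answer (simulated M T c).state = some false := by
  simp only [pullback, simulated]
  split_ifs with h <;> simp [h]

lemma pullback_rejects_iff {w : List X} :
    (M.pullback T).Rejects w ↔ M.Rejects (T.output T.start w) := by
  unfold Rejects Terminates
  simp only [pullback_timeBound_iff]
  refine and_congr_right fun _ => ⟨fun h c hc => ?_, fun h c hc => ?_⟩
  · obtain ⟨c', hc', rfl⟩ := hc.lift
    exact (pullback_answer_eq_no c').1 (h c' hc')
  · exact (pullback_answer_eq_no c).2 (h _ hc.simulated)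

end Machine

/-- If `D` is in `C` and the transducer `T` maps all words of `E` into `D`, then some machine
admissible for `C`, correct for `E`, decides within the bounds of `C` on all words
that `T` maps outside of `D`. -/
lemma InClass.exists_pullback {X Y : Type} {C : ComplexityClass} {D : Set (List Y)}
    (h : InClass C D) (T : Transducer X Y) {E : Set (List X)}
    (hE : ∀ w ∈ E, T.output T.start w ∈ D) :
    ∃ M : Machine X, C.AllowsMode M ∧ CorrectFor M E ∧
      C.DecidesOn M {w | T.output T.start w ∉ D} := by
  obtain ⟨M, hmode, hcor, hdec, htime, hspace⟩ := h
  refine ⟨M.pullback T, fun hC => M.pullback_deterministic T (hmode hC), fun w => ⟨fun hw =>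
    absurd hw (Machine.pullback_not_accepts w), fun hw hwE => ?_⟩, fun w hw => ?_, ?_, ?_⟩
  · exact (hcor _).2 (Machine.pullback_rejects_iff.1 hw) (hE w hwE)
  · have hrej : (M.pullback T).Rejects w := by
      rw [Machine.pullback_rejects_iff]
      exact (hdec _ (Set.mem_univ _)).2.resolve_left fun ha => hw ((hcor _).1 ha)
    exact ⟨hrej.1, Or.inr hrej⟩
  · intro F hF
    obtain ⟨f, hf, hb⟩ := htime F hF
    -- The same `f` serves because the transducer preserves length.
    refine ⟨f, hf, fun w _ => Machine.pullback_timeBound_iff.2 ?_⟩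
    simpa using hb (T.output T.start w) (Set.mem_univ _)
  · intro F hF
    obtain ⟨f, hf, hb⟩ := hspace F hF
    refine ⟨f, hf, fun w _ => Machine.pullback_spaceBound ?_⟩
    simpa using hb (T.output T.start w) (Set.mem_univ _)

/-! ### Counting words -/

section Counting

variable {X : Type} [Fintype X]

/-- The number of words of length `n` in a set of words. -/
noncomputable def wordCount (S : Set (List X)) (n : ℕ) : ℕ :=
  {w : List X | w.length = n ∧ w ∈ S}.ncard

lemma finite_words (S : Set (List X)) (n : ℕ) : {w : List X | w.length = n ∧ w ∈ S}.Finite :=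
  (List.finite_length_eq X n).subset fun _ h => h.1

lemma wordCount_zero (S : Set (List X)) [Decidable ([] ∈ S)] :
    wordCount S 0 = if [] ∈ S then 1 else 0 := by
  unfold wordCount
  split_ifs with h
  · rw [Set.ncard_eq_one]
    refine ⟨[], ?_⟩
    ext w
    simp only [List.length_eq_zero_iff, Set.mem_ofPred_eq, Set.mem_singleton_iff]
    exact ⟨fun h => h.1, fun hw => ⟨hw, hw ▸ h⟩⟩
  · rw [Set.ncard_eq_zero (finite_words S 0)]
    ext w
    simp only [List.length_eq_zero_iff, Set.mem_ofPred_eq, Set.mem_empty_iff_false, iff_false]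
    rintro ⟨rfl, h'⟩
    exact h h'

lemma wordCount_succ (S : Set (List X)) (n : ℕ) :
    wordCount S (n + 1) = ∑ x, wordCount {w | x :: w ∈ S} n := by
  have hfin : ∀ x, Finite {w : List X | w.length = n ∧ w ∈ {w | x :: w ∈ S}} :=
    fun x => (finite_words _ n).to_subtype
  let e : {w : List X | w.length = n + 1 ∧ w ∈ S} ≃
      Σ x, {w : List X | w.length = n ∧ w ∈ {w | x :: w ∈ S}} :=
    { toFun := fun w => match w with
        | ⟨x :: w, h⟩ => ⟨x, w, by simpa using h.1, h.2⟩
      invFun := fun z => ⟨z.1 :: z.2.1, by simpa using z.2.2.1, z.2.2.2⟩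
      left_inv := by
        rintro ⟨_ | ⟨x, w⟩, h⟩
        · simp at h
        · rfl
      right_inv := fun _ => rfl }
  unfold wordCount
  rw [← Nat.card_coe_set_eq, Nat.card_congr e, Nat.card_sigma]
  simp only [Nat.card_coe_set_eq]

lemma wordCount_univ (n : ℕ) : wordCount (Set.univ : Set (List X)) n = Fintype.card X ^ n := by
  classical
  induction n with
  | zero => simp [wordCount_zero]
  | succ n ih =>
    rw [wordCount_succ]
    have h : ∀ x : X, {w : List X | x :: w ∈ Set.univ} = Set.univ := fun x => by ext; simp
    simp only [h, ih, Finset.sum_const, Finset.card_univ, smul_eq_mul]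
    ring

lemma wordCount_mono {S S' : Set (List X)} (h : S ⊆ S') (n : ℕ) :
    wordCount S n ≤ wordCount S' n :=
  Set.ncard_le_ncard (fun _ hw => ⟨hw.1, h hw.2⟩) (finite_words S' n)

lemma wordCount_le (S : Set (List X)) (n : ℕ) : wordCount S n ≤ Fintype.card X ^ n :=
  wordCount_univ (X := X) n ▸ wordCount_mono (Set.subset_univ S) n

omit [Fintype X] in
lemma wordCount_iUnion_le {ι : Type*} [Fintype ι] (S : ι → Set (List X)) (n : ℕ) :
    wordCount (⋃ i, S i) n ≤ ∑ i, wordCount (S i) n := by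
  classical
  have : {w : List X | w.length = n ∧ w ∈ ⋃ i, S i} =
      ⋃ i ∈ (Finset.univ : Finset ι), {w : List X | w.length = n ∧ w ∈ S i} := by
    ext w
    simp
  unfold wordCount
  rw [this]
  exact Finset.set_ncard_biUnion_le _ _

lemma ncard_inter_length_le (S : Set (List X)) (n : ℕ) :
    (S ∩ {w | w.length ≤ n}).ncard = ∑ j ∈ Finset.range (n + 1), wordCount S j := by
  induction n with
  | zero =>
    simp only [Nat.le_zero, zero_add, Finset.sum_range_one, wordCount]
    congr 1
    ext w
    simp [and_comm]
  | succ n ih =>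
    rw [Finset.sum_range_succ, ← ih, wordCount, ← Set.ncard_union_eq ?_
      ((List.finite_length_le X n).subset fun _ h => h.2) (finite_words _ _)]
    · congr 1
      ext w
      simp only [Set.mem_inter_iff, Set.mem_ofPred_eq, Set.mem_union]
      constructor
      · rintro ⟨h1, h2⟩
        rcases Nat.lt_or_ge w.length (n + 1) with h | h
        · exact Or.inl ⟨h1, by omega⟩
        · exact Or.inr ⟨by omega, h1⟩
      · rintro (⟨h1, h2⟩ | ⟨h1, h2⟩)
        · exact ⟨h1, by omega⟩
        · exact ⟨h2, by omega⟩
    · rw [Set.disjoint_left]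
      rintro w ⟨-, h⟩ ⟨h', -⟩
      simp only [Set.mem_ofPred_eq] at h
      omega

lemma ncard_length_le (n : ℕ) :
    ({w | w.length ≤ n} : Set (List X)).ncard =
      ∑ j ∈ Finset.range (n + 1), Fintype.card X ^ j := by
  have := ncard_inter_length_le (Set.univ : Set (List X)) n
  simpa only [Set.univ_inter, wordCount_univ] using this

lemma one_sub_density (S : Set (List X)) [Nonempty X] (n : ℕ) :
    1 - density S n = (∑ j ∈ Finset.range (n + 1), (wordCount Sᶜ j : ℝ)) /
      ∑ j ∈ Finset.range (n + 1), (Fintype.card X : ℝ) ^ j := by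
  have hfin := List.finite_length_le X n
  have hadd : (S ∩ {w | w.length ≤ n}).ncard + (Sᶜ ∩ {w | w.length ≤ n}).ncard =
      ({w | w.length ≤ n} : Set (List X)).ncard := by
    rw [← Set.ncard_union_eq _ (hfin.subset Set.inter_subset_right)
      (hfin.subset Set.inter_subset_right), ← Set.union_inter_distrib_right, Set.union_compl_self,
      Set.univ_inter]
    exact (disjoint_compl_right.mono Set.inter_subset_left Set.inter_subset_left)
  have hpos : (0 : ℝ) < ∑ j ∈ Finset.range (n + 1), (Fintype.card X : ℝ) ^ j :=
    Finset.sum_pos (fun j _ => by have := Fintype.card_pos (α := X); positivity) (by simp)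
  have hden : (({w | w.length ≤ n} : Set (List X)).ncard : ℝ) =
      ∑ j ∈ Finset.range (n + 1), (Fintype.card X : ℝ) ^ j := by
    rw [ncard_length_le]; push_cast; rfl
  have hadd' := congrArg (fun m : ℕ => (m : ℝ)) hadd
  push_cast at hadd'
  rw [ncard_inter_length_le Sᶜ n, hden] at hadd'
  push_cast at hadd'
  unfold density
  rw [hden, eq_div_iff hpos.ne', sub_mul, div_mul_cancel₀ _ hpos.ne']
  linarith

/-- Density is measured on balls, the walk on spheres. Termwise little-o passes to partial sums
because the sphere sizes have divergent sum, even for a single letter. -/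
lemma generic_of_tendsto (hX : 1 ≤ Fintype.card X) {S : Set (List X)}
    (h : Tendsto (fun n => (wordCount Sᶜ n : ℝ) / (Fintype.card X : ℝ) ^ n) atTop (𝓝 0)) :
    Generic S := by
  have : Nonempty X := Fintype.card_pos_iff.1 hX
  have hd : (1 : ℝ) ≤ Fintype.card X := by exact_mod_cast hX
  have hlo : (fun n => (wordCount Sᶜ n : ℝ)) =o[atTop] fun n => (Fintype.card X : ℝ) ^ n := by
    rw [Asymptotics.isLittleO_iff_tendsto']
    · exact h
    · exact Eventually.of_forall fun n hn => absurd hn (by positivity)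
  have hsum := hlo.sum_range (fun n => by positivity) (by
    refine tendsto_atTop_mono (fun n => ?_) tendsto_natCast_atTop_atTop
    calc (n : ℝ) = ∑ _j ∈ Finset.range n, (1 : ℝ) := by simp
      _ ≤ _ := Finset.sum_le_sum fun j _ => one_le_pow₀ hd)
  have ht := (hsum.tendsto_div_nhds_zero).comp (tendsto_add_atTop_nat 1)
  have ht' : Tendsto (fun n => 1 - density S n) atTop (𝓝 0) := by
    simp only [one_sub_density]
    exact ht
  have := ht'.const_sub 1
  simpa [Generic] using this

lemma geom_sum_le_three_mul_pow {r : ℝ} (hr : 3 / 2 ≤ r) (n : ℕ) :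
    ∑ j ∈ Finset.range (n + 1), r ^ j ≤ 3 * r ^ n := by
  induction n with
  | zero => simp
  | succ n ih =>
    rw [Finset.sum_range_succ]
    have : 0 < r ^ n := by positivity
    have h : 3 * r ^ n ≤ 2 * r ^ (n + 1) := by
      rw [pow_succ]
      nlinarith
    linarith

lemma stronglyGeneric_of_le (hX : 2 ≤ Fintype.card X) {S : Set (List X)} {σ C : ℝ} (hσ0 : 0 ≤ σ)
    (hσ : σ < 1) (h : ∀ n, (wordCount Sᶜ n : ℝ) ≤ C * (σ * Fintype.card X) ^ n) :
    StronglyGeneric S := by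
  have : Nonempty X := Fintype.card_pos_iff.1 (by omega)
  set d : ℝ := (Fintype.card X : ℝ) with hd
  have hd2 : 2 ≤ d := by rw [hd]; exact_mod_cast hX
  have hC : 0 ≤ C := by
    have h0 := h 0
    rw [pow_zero, mul_one] at h0
    exact (Nat.cast_nonneg _).trans h0
  -- With `d ≥ 2` letters, a rate of at least `3 / 4` makes the ratio `τ * d` at least `3 / 2`, so
  -- the geometric sum is at most three times its last term. The `+ 1` makes the constant strictly
  -- positive.
  refine ⟨generic_of_tendsto (by omega) ?_, max σ (3 / 4), 3 * C + 1, by positivity, ?_,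
    by positivity, fun n _ => ?_⟩
  · have hz : Tendsto (fun n => C * σ ^ n) atTop (𝓝 0) := by
      simpa using (tendsto_pow_atTop_nhds_zero_of_lt_one hσ0 hσ).const_mul C
    refine squeeze_zero (fun n => by positivity) (fun n => ?_) hz
    rw [← hd, div_le_iff₀ (by positivity), mul_assoc, ← mul_pow]
    exact h n
  · rw [max_lt_iff]
    norm_num [hσ]
  · set τ := max σ (3 / 4)
    have hτ : 3 / 4 ≤ τ := le_max_right _ _
    have hστ : σ ≤ τ := le_max_left _ _
    have hdn : d ^ n ≤ ∑ j ∈ Finset.range (n + 1), d ^ j :=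
      Finset.single_le_sum (f := fun j => d ^ j) (fun j _ => by positivity)
        (Finset.self_mem_range_succ n)
    have hnum : ∑ j ∈ Finset.range (n + 1), (wordCount Sᶜ j : ℝ) ≤ 3 * C * (τ * d) ^ n := by
      calc ∑ j ∈ Finset.range (n + 1), (wordCount Sᶜ j : ℝ)
          ≤ ∑ j ∈ Finset.range (n + 1), C * (τ * d) ^ j :=
            Finset.sum_le_sum fun j _ => (h j).trans (by gcongr)
        _ = C * ∑ j ∈ Finset.range (n + 1), (τ * d) ^ j := by rw [Finset.mul_sum]
        _ ≤ C * (3 * (τ * d) ^ n) := by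
            gcongr
            exact geom_sum_le_three_mul_pow (by nlinarith) n
        _ = _ := by ring
    rw [one_sub_density, ← hd, div_le_iff₀ (lt_of_lt_of_le (by positivity) hdn)]
    calc _ ≤ 3 * C * (τ * d) ^ n := hnum
      _ ≤ (3 * C + 1) * (τ * d) ^ n := by gcongr; linarith
      _ = (3 * C + 1) * τ ^ n * d ^ n := by rw [mul_pow]; ring
      _ ≤ _ := by gcongr

end Counting

/-! ### Finitely supported functions as a pre-Hilbert space -/

section FinsuppInner

variable {X : Type*}

/-- The standard inner product of finitely supported real functions. -/
noncomputable abbrev finsuppCore (X : Type*) : PreInnerProductSpace.Core ℝ (X →₀ ℝ) where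
  inner f g := f.sum fun x c => c * g x
  conj_inner_symm f g := by
    classical
    simp only [conj_trivial]
    rw [Finsupp.sum_of_support_subset g (s := f.support ∪ g.support) Finset.subset_union_right _
      (by simp), Finsupp.sum_of_support_subset f (s := f.support ∪ g.support)
      Finset.subset_union_left _ (by simp)]
    exact Finset.sum_congr rfl fun x _ => mul_comm _ _
  re_inner_nonneg f := Finset.sum_nonneg fun x _ => mul_self_nonneg (f x)
  add_left f g h := by
    rw [Finsupp.sum_add_index']
    · simp
    · intro a b c; ring
  smul_left f g r := by
    rw [Finsupp.sum_smul_index (by simp), Finsupp.mul_sum]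
    simp [mul_assoc]

/-- No `ℓ²` completion is needed: symmetry, Cauchy–Schwarz and polarisation on finitely supported
functions replace the spectral theorem. -/
noncomputable instance : SeminormedAddCommGroup (X →₀ ℝ) :=
  letI := finsuppCore X
  InnerProductSpace.Core.toSeminormedAddCommGroup (𝕜 := ℝ)

noncomputable instance : InnerProductSpace ℝ (X →₀ ℝ) :=
  InnerProductSpace.ofCore (finsuppCore X)

lemma finsupp_inner_def (f g : X →₀ ℝ) : inner ℝ f g = f.sum fun x c => c * g x := rfl

lemma finsupp_inner_eq_sum (f g : X →₀ ℝ) {s : Finset X} (hs : f.support ⊆ s) :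
    inner ℝ f g = ∑ x ∈ s, f x * g x := by
  rw [finsupp_inner_def, Finsupp.sum_of_support_subset f hs _ (by simp)]

lemma finsupp_norm_sq (f : X →₀ ℝ) {s : Finset X} (hs : f.support ⊆ s) :
    ‖f‖ ^ 2 = ∑ x ∈ s, f x ^ 2 := by
  rw [← real_inner_self_eq_norm_sq, finsupp_inner_eq_sum f f hs]
  simp only [sq]

lemma finsupp_inner_single (f : X →₀ ℝ) (v : X) : inner ℝ f (Finsupp.single v 1) = f v := by
  rw [real_inner_comm, finsupp_inner_def, Finsupp.sum_single_index] <;> simp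

lemma finsupp_norm_single (v : X) : ‖(Finsupp.single v 1 : X →₀ ℝ)‖ = 1 := by
  have : ‖(Finsupp.single v 1 : X →₀ ℝ)‖ ^ 2 = 1 := by
    rw [← real_inner_self_eq_norm_sq, finsupp_inner_single, Finsupp.single_eq_same]
  exact (pow_eq_one_iff_of_nonneg (norm_nonneg _) two_ne_zero).1 this

lemma finsupp_abs_apply_le_norm (f : X →₀ ℝ) (v : X) : |f v| ≤ ‖f‖ := by
  rw [← finsupp_inner_single]
  simpa [finsupp_norm_single] using abs_real_inner_le_norm f (Finsupp.single v 1)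

lemma finsupp_norm_mapRange_abs (f : X →₀ ℝ) : ‖f.mapRange (fun c => |c|) abs_zero‖ = ‖f‖ := by
  rw [← sq_eq_sq₀ (norm_nonneg _) (norm_nonneg _), finsupp_norm_sq f subset_rfl,
    finsupp_norm_sq _ (Finsupp.support_mapRange (hf := abs_zero))]
  simp

/-- Restriction along an injective map does not increase the norm. -/
lemma finsupp_norm_comapDomain_le {Y : Type*} {ι : Y → X} (hι : Function.Injective ι)
    (f : X →₀ ℝ) : ‖f.comapDomain ι hι.injOn‖ ≤ ‖f‖ := by
  classical
  rw [← sq_le_sq₀ (norm_nonneg _) (norm_nonneg _), finsupp_norm_sq f subset_rfl,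
    finsupp_norm_sq _ subset_rfl]
  simp only [Finsupp.comapDomain_apply]
  rw [← Finset.sum_image (f := fun x => f x ^ 2) (g := ι) hι.injOn]
  refine Finset.sum_le_sum_of_subset_of_nonneg ?_ fun _ _ _ => sq_nonneg _
  intro x hx
  obtain ⟨y, hy, rfl⟩ := Finset.mem_image.1 hx
  simpa using hy

/-- Restrictions along jointly surjective maps control the norm. -/
lemma finsupp_norm_sq_le_sum_comapDomain {Y I : Type*} [Fintype I] {ι : I → Y → X}
    (hι : ∀ i, Function.Injective (ι i)) (hsurj : ∀ x, ∃ i y, ι i y = x) (f : X →₀ ℝ) :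
    ‖f‖ ^ 2 ≤ ∑ i, ‖f.comapDomain (ι i) (hι i).injOn‖ ^ 2 := by
  classical
  choose i y hiy using hsurj
  have hinj : Function.Injective fun x => (⟨i x, y x⟩ : Σ _ : I, Y) := by
    intro x x' h
    have h1 := congrArg (fun z : Σ _ : I, Y => ι z.1 z.2) h
    simpa [hiy] using h1
  simp only [finsupp_norm_sq _ subset_rfl]
  rw [Finset.sum_sigma' Finset.univ (fun j => (f.comapDomain (ι j) (hι j).injOn).support)
    (fun j z => f.comapDomain (ι j) (hι j).injOn z ^ 2)]
  calc ∑ x ∈ f.support, f x ^ 2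
      = ∑ z ∈ f.support.image (fun x => (⟨i x, y x⟩ : Σ _ : I, Y)), f (ι z.1 z.2) ^ 2 := by
        rw [Finset.sum_image hinj.injOn]
        simp [hiy]
    _ ≤ _ := by
        refine Finset.sum_le_sum_of_subset_of_nonneg ?_ fun _ _ _ => sq_nonneg _
        intro z hz
        obtain ⟨x, hx, rfl⟩ := Finset.mem_image.1 hz
        simpa [hiy] using hx

end FinsuppInner

/-! ### The permutation representation -/

section Representation

variable {G X : Type*} [Group G] [MulAction G X]

/-- The action of a group element on finitely supported functions. -/
noncomputable def translation (X : Type*) [MulAction G X] (g : G) : (X →₀ ℝ) →ₗ[ℝ] (X →₀ ℝ) :=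
  Finsupp.lmapDomain ℝ ℝ (g • ·)

lemma translation_apply (g : G) (f : X →₀ ℝ) (x : X) : translation X g f x = f (g⁻¹ • x) :=
  Finsupp.mapDomain_equiv_apply (f := MulAction.toPerm g) f x

lemma translation_one (f : X →₀ ℝ) : translation X (1 : G) f = f := by
  ext x; simp [translation_apply]

lemma translation_mul (g h : G) (f : X →₀ ℝ) :
    translation X (g * h) f = translation X g (translation X h f) := by
  ext x; simp [translation_apply, mul_smul]

lemma inner_translation_left (g : G) (f h : X →₀ ℝ) :
    inner ℝ (translation X g f) h = inner ℝ f (translation X g⁻¹ h) := by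
  rw [finsupp_inner_def, finsupp_inner_def, translation, Finsupp.lmapDomain_apply,
    Finsupp.sum_mapDomain_index (by simp) (by intros; ring)]
  simp [translation_apply]

lemma norm_translation (g : G) (f : X →₀ ℝ) : ‖translation X g f‖ = ‖f‖ := by
  rw [← sq_eq_sq₀ (norm_nonneg _) (norm_nonneg _), ← real_inner_self_eq_norm_sq,
    ← real_inner_self_eq_norm_sq, inner_translation_left, ← translation_mul, inv_mul_cancel,
    translation_one]

/-- The displacement of a function under a group element. -/
noncomputable def displacement (g : G) (f : X →₀ ℝ) : ℝ := ‖translation X g f - f‖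

lemma displacement_sq (g : G) (f : X →₀ ℝ) :
    displacement g f ^ 2 = 2 * (‖f‖ ^ 2 - inner ℝ (translation X g f) f) := by
  rw [displacement, norm_sub_sq_real, norm_translation]
  ring

lemma displacement_nonneg (g : G) (f : X →₀ ℝ) : 0 ≤ displacement g f := norm_nonneg _

lemma displacement_one (f : X →₀ ℝ) : displacement (1 : G) f = 0 := by
  simp [displacement, translation_one]

lemma displacement_mul_le (g h : G) (f : X →₀ ℝ) :
    displacement (g * h) f ≤ displacement g f + displacement h f := by
  have : translation X (g * h) f - f =
      translation X g (translation X h f - f) + (translation X g f - f) := by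
    rw [translation_mul, map_sub]; abel
  unfold displacement
  rw [this, add_comm ‖translation X g f - f‖]
  exact (norm_add_le _ _).trans_eq (by rw [norm_translation])

lemma displacement_inv (g : G) (f : X →₀ ℝ) : displacement g⁻¹ f = displacement g f := by
  have : translation X g⁻¹ f - f = translation X g⁻¹ (f - translation X g f) := by
    rw [map_sub, ← translation_mul, inv_mul_cancel, translation_one]
  rw [displacement, this, norm_translation, norm_sub_rev, displacement]

end Representation

/-! ### The simple random walk -/

section Walk

variable {G X : Type*} [Group G] [MulAction G X] {k : ℕ} (a : Fin k → G)

lemma letterVal_not (x : Fin k × Bool) : letterVal a (x.1, !x.2) = (letterVal a x)⁻¹ := by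
  rcases x with ⟨i, _ | _⟩ <;> simp [letterVal]

lemma sum_letters_inv {M : Type*} [AddCommMonoid M] (F : G → M) :
    ∑ x, F (letterVal a x)⁻¹ = ∑ x, F (letterVal a x) := by
  simp only [← letterVal_not]
  exact Fintype.sum_equiv ((Equiv.refl (Fin k)).prodCongr Equiv.boolNot) _ _ fun _ => rfl

lemma wordVal_nil : wordVal a [] = 1 := rfl

lemma wordVal_cons (x : Fin k × Bool) (w : List (Fin k × Bool)) :
    wordVal a (x :: w) = letterVal a x * wordVal a w := by
  simp [wordVal]

/-- A set that contains `1` and is stable under left multiplication by letters is everything. -/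
lemma Generates.induction {a : Fin k → G} (ha : Generates a) {p : G → Prop} (one : p 1)
    (mul : ∀ x g, p g → p (letterVal a x * g)) (g : G) : p g := by
  have hg : g ∈ Subgroup.closure (Set.range a) := by rw [ha]; trivial
  induction hg using Subgroup.closure_induction_left with
  | one => exact one
  | mul_left x hx y _ ih =>
    obtain ⟨i, rfl⟩ := hx
    simpa [letterVal] using mul (i, true) y ih
  | inv_mul_cancel x hx y _ ih =>
    obtain ⟨i, rfl⟩ := hx
    simpa [letterVal] using mul (i, false) y ih

lemma Generates.exists_word {a : Fin k → G} (ha : Generates a) (g : G) :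
    ∃ w, wordVal a w = g := by
  induction g using ha.induction with
  | one => exact ⟨[], rfl⟩
  | mul x g ih =>
    obtain ⟨w, rfl⟩ := ih
    exact ⟨x :: w, wordVal_cons a x w⟩

variable (X)

/-- The transition operator of the simple random walk. -/
noncomputable def walkOp : (X →₀ ℝ) →ₗ[ℝ] (X →₀ ℝ) :=
  (2 * (k : ℝ))⁻¹ • ∑ x, translation X (letterVal a x)

variable {X}

lemma walkOp_eq (f : X →₀ ℝ) :
    walkOp X a f = (2 * (k : ℝ))⁻¹ • ∑ x, translation X (letterVal a x) f := by
  simp [walkOp]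

lemma walkOp_apply (f : X →₀ ℝ) (v : X) :
    walkOp X a f v = (2 * (k : ℝ))⁻¹ * ∑ x, f ((letterVal a x)⁻¹ • v) := by
  simp [walkOp_eq, translation_apply]

lemma inner_walkOp (f h : X →₀ ℝ) :
    inner ℝ (walkOp X a f) h =
      (2 * (k : ℝ))⁻¹ * ∑ x, inner ℝ (translation X (letterVal a x) f) h := by
  rw [walkOp_eq, real_inner_smul_left, sum_inner]

/-- The adjoint of a translation is the inverse translation, and the set of letters is closed under
inversion. -/
lemma walkOp_isSymmetric : (walkOp X a).IsSymmetric := by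
  intro f h
  rw [inner_walkOp, real_inner_comm, inner_walkOp]
  congr 1
  simp only [inner_translation_left]
  rw [sum_letters_inv a fun g => inner ℝ f (translation X g h)]
  exact Finset.sum_congr rfl fun x _ => by rw [← inner_translation_left, real_inner_comm,
    inner_translation_left]

lemma norm_walkOp_le (f : X →₀ ℝ) : ‖walkOp X a f‖ ≤ ‖f‖ := by
  rw [walkOp_eq, norm_smul, Real.norm_of_nonneg (by positivity)]
  have h : ‖∑ x, translation X (letterVal a x) f‖ ≤ 2 * k * ‖f‖ :=
    (norm_sum_le _ _).trans_eq (by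
      simp only [norm_translation, Finset.sum_const, Finset.card_univ, Fintype.card_prod,
        Fintype.card_fin, Fintype.card_bool, nsmul_eq_mul]
      push_cast; ring)
  rcases Nat.eq_zero_or_pos k with rfl | hk
  · simp
  · have hk' : (0 : ℝ) < k := by exact_mod_cast hk
    rw [inv_mul_le_iff₀ (by positivity)]
    exact h

/-- The mass at `v` after `n` steps from `u` counts the words that move `u` to `v`. -/
lemma walkOp_pow_single (n : ℕ) (u v : X) :
    ((walkOp X a) ^ n) (Finsupp.single u 1) v =
      (wordCount {w | wordVal a w • u = v} n : ℝ) / (2 * (k : ℝ)) ^ n := by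
  classical
  induction n generalizing v with
  | zero =>
    rw [wordCount_zero]
    simp [wordVal_nil, Finsupp.single_apply]
  | succ n ih =>
    rw [pow_succ', Module.End.mul_apply, walkOp_apply, wordCount_succ]
    simp only [ih]
    rw [← Finset.sum_div, pow_succ', inv_mul_eq_div, div_div, mul_comm (_ ^ n)]
    push_cast
    congr 1
    refine Finset.sum_congr rfl fun x _ => ?_
    congr 2
    ext w
    simp [wordVal_cons, mul_smul, eq_inv_smul_iff]

lemma walkOp_pow_single_nonneg (n : ℕ) (u v : X) :
    0 ≤ ((walkOp X a) ^ n) (Finsupp.single u 1) v := by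
  rw [walkOp_pow_single]
  positivity

lemma sum_walkOp_pow_single_le_one (n : ℕ) (u : X) (F : Finset X) :
    ∑ v ∈ F, ((walkOp X a) ^ n) (Finsupp.single u 1) v ≤ 1 := by
  classical
  induction n generalizing F with
  | zero =>
    simp only [pow_zero, Module.End.one_apply, Finsupp.single_apply, Finset.sum_ite_eq]
    split_ifs <;> norm_num
  | succ n ih =>
    simp only [pow_succ', Module.End.mul_apply, walkOp_apply]
    rw [← Finset.mul_sum, Finset.sum_comm]
    have h : ∀ x : Fin k × Bool, ∑ v ∈ F,
        ((walkOp X a) ^ n) (Finsupp.single u 1) ((letterVal a x)⁻¹ • v) ≤ 1 := fun x => by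
      rw [← Finset.sum_image (f := fun v => ((walkOp X a) ^ n) (Finsupp.single u 1) v)
        (g := fun v => (letterVal a x)⁻¹ • v) (MulAction.injective _).injOn]
      exact ih _
    have hs := Finset.sum_le_sum fun x (_ : x ∈ (Finset.univ : Finset (Fin k × Bool))) => h x
    have hc : ∑ _x : Fin k × Bool, (1 : ℝ) = 2 * k := by simp [mul_comm]
    rw [hc] at hs
    rcases Nat.eq_zero_or_pos k with rfl | hk
    · simp
    · have hk' : (0 : ℝ) < k := by exact_mod_cast hk
      rw [inv_mul_le_iff₀ (by positivity), mul_one]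
      exact hs

/-- This is the Dirichlet form of the walk: a gap for the letters is an upper bound below 1 for the
quadratic form of `P`. -/
lemma sum_displacement_sq (hk : 0 < k) (f : X →₀ ℝ) :
    ∑ x, displacement (letterVal a x) f ^ 2 =
      2 * (2 * k) * (‖f‖ ^ 2 - inner ℝ (walkOp X a f) f) := by
  have hk' : (k : ℝ) ≠ 0 := by exact_mod_cast hk.ne'
  simp only [displacement_sq]
  rw [← Finset.mul_sum, Finset.sum_sub_distrib, inner_walkOp]
  simp only [Finset.sum_const, Finset.card_univ, Fintype.card_prod, Fintype.card_fin,
    Fintype.card_bool, nsmul_eq_mul]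
  push_cast
  field_simp

lemma inner_walkOp_pow (m n : ℕ) (f h : X →₀ ℝ) :
    inner ℝ (((walkOp X a) ^ m) f) (((walkOp X a) ^ n) h) =
      inner ℝ (((walkOp X a) ^ (m + n)) f) h := by
  rw [add_comm m n, pow_add, Module.End.mul_apply, ((walkOp_isSymmetric a).pow n)]

end Walk

/-! ### Infinite orbits: the walk escapes from every point -/

section Escape

variable {G X : Type*} [Group G] [MulAction G X] {k : ℕ} {a : Fin k → G}

lemma Generates.pos_of_nontrivial [Nontrivial G] (ha : Generates a) : 0 < k := by
  rcases Nat.eq_zero_or_pos k with rfl | hk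
  · obtain ⟨g, hg⟩ := exists_ne (1 : G)
    exact absurd (ha.induction (p := fun g => g = 1) rfl (fun x => x.1.elim0) g) hg
  · exact hk

/-- Expanding `‖Pf‖²` over pairs of letters shows that the right-hand side is the sum of all squared
displacements under `y⁻¹x`; a single term is at most that sum. -/
lemma displacement_sq_le (hk : 0 < k) (x y : Fin k × Bool) (f : X →₀ ℝ) :
    displacement ((letterVal a y)⁻¹ * letterVal a x) f ^ 2 ≤
      2 * (2 * (k : ℝ)) ^ 2 * (‖f‖ ^ 2 - ‖walkOp X a f‖ ^ 2) := by
  have hk' : (k : ℝ) ≠ 0 := by exact_mod_cast hk.ne'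
  have hsum : ∑ y, ∑ x, displacement ((letterVal a y)⁻¹ * letterVal a x) f ^ 2 =
      2 * (2 * (k : ℝ)) ^ 2 * (‖f‖ ^ 2 - ‖walkOp X a f‖ ^ 2) := by
    have hP : ‖walkOp X a f‖ ^ 2 = (2 * (k : ℝ))⁻¹ * ((2 * (k : ℝ))⁻¹ * ∑ y, ∑ x,
        inner ℝ (translation X ((letterVal a y)⁻¹ * letterVal a x) f) f) := by
      rw [← real_inner_self_eq_norm_sq, inner_walkOp]
      congr 1
      have h : ∀ x, inner ℝ (translation X (letterVal a x) f) (walkOp X a f) =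
          (2 * (k : ℝ))⁻¹ * ∑ y,
            inner ℝ (translation X ((letterVal a y)⁻¹ * letterVal a x) f) f := fun x => by
        rw [real_inner_comm, inner_walkOp]
        congr 1
        refine Finset.sum_congr rfl fun y _ => ?_
        rw [inner_translation_left, ← translation_mul, real_inner_comm]
      simp only [h]
      rw [← Finset.mul_sum, Finset.sum_comm]
    rw [hP]
    simp only [displacement_sq]
    simp only [← Finset.mul_sum, Finset.sum_sub_distrib, Finset.sum_const, Finset.card_univ,
      Fintype.card_prod, Fintype.card_fin, Fintype.card_bool, nsmul_eq_mul]
    push_cast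
    field_simp
  rw [← hsum]
  refine (Finset.single_le_sum (f := fun x => displacement ((letterVal a y)⁻¹ * letterVal a x) f
    ^ 2) (fun _ _ => sq_nonneg _) (Finset.mem_univ x)).trans ?_
  exact Finset.single_le_sum (f := fun y => ∑ x,
    displacement ((letterVal a y)⁻¹ * letterVal a x) f ^ 2)
    (fun _ _ => Finset.sum_nonneg fun _ _ => sq_nonneg _) (Finset.mem_univ y)

lemma walkOp_return (n : ℕ) (u : X) :
    ((walkOp X a) ^ (n + n)) (Finsupp.single u 1) u =
      ‖((walkOp X a) ^ n) (Finsupp.single u 1)‖ ^ 2 := by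
  rw [← finsupp_inner_single, ← inner_walkOp_pow, real_inner_self_eq_norm_sq]

lemma antitone_norm_walkOp_pow (f : X →₀ ℝ) :
    Antitone fun n => ‖((walkOp X a) ^ n) f‖ ^ 2 :=
  antitone_nat_of_succ_le fun n => by
    rw [pow_succ' (walkOp X a), Module.End.mul_apply]
    gcongr
    exact norm_walkOp_le a _

/-- If the displacements of a sequence of functions under all products of two letters tend to
zero, then so do the displacements of infinitely many points of an infinite orbit. -/
lemma infinite_setOf_displacement_tendsto [Infinite X] [MulAction.IsPretransitive G X]
    (hk : 0 < k) (ha : Generates a) (u : X) {f : ℕ → X →₀ ℝ}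
    (hf : ∀ x y, Tendsto (fun n => displacement (letterVal a x * letterVal a y) (f n))
      atTop (𝓝 0)) :
    {v : X | ∃ g : G, g • u = v ∧ Tendsto (fun n => displacement g (f n)) atTop (𝓝 0)}.Infinite := by
  set E : G → Prop := fun g => Tendsto (fun n => displacement g (f n)) atTop (𝓝 0) with hE
  have hmul : ∀ g h, E g → E h → E (g * h) := fun g h hg hh =>
    squeeze_zero (fun n => displacement_nonneg _ _) (fun n => displacement_mul_le g h _)
      (by simpa using hg.add hh)
  have h1 : E 1 := by simp [hE, displacement_one]
  set l := letterVal a (⟨0, hk⟩, true) with hl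
  have hl' : letterVal a (⟨0, hk⟩, false) = l⁻¹ := letterVal_not a (⟨0, hk⟩, true)
  -- Only products of two letters are known to lie in `E`; if the graph is bipartite, single letters
  -- need not. A fixed letter `l` corrects the parity.
  have hcov : ∀ g, E g ∨ E (l * g) := by
    refine ha.induction (Or.inl h1) fun x g hg => ?_
    rcases hg with hg | hg
    · right
      rw [← mul_assoc]
      exact hmul _ _ (hf _ _) hg
    · left
      have := hmul _ _ (hf x (⟨0, hk⟩, false)) hg
      rwa [hl', mul_assoc, inv_mul_cancel_left] at this
  intro hfin
  refine Set.infinite_univ (α := X) ((hfin.union (hfin.image (l⁻¹ • ·))).subset fun v _ => ?_)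
  obtain ⟨g, rfl⟩ := MulAction.exists_smul_eq G u v
  rcases hcov g with hg | hg
  · exact Or.inl ⟨g, rfl, hg⟩
  · exact Or.inr ⟨(l * g) • u, ⟨_, rfl, hg⟩, by simp [mul_smul]⟩

/-- The drops `c n - c (n + 1)` control displacements under two-letter products, hence `P²ⁿδ`
differs by `o(1)` between `u` and infinitely many other points. Its value at `u` is `c n`, so the
limit `L` is attained asymptotically at all of them, while the total mass is at most 1. -/
theorem tendsto_norm_walkOp_pow_single [Infinite X] [MulAction.IsPretransitive G X]
    (hk : 0 < k) (ha : Generates a) (u : X) :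
    Tendsto (fun n => ‖((walkOp X a) ^ n) (Finsupp.single u 1)‖ ^ 2) atTop (𝓝 0) := by
  set f : ℕ → X →₀ ℝ := fun n => ((walkOp X a) ^ n) (Finsupp.single u 1) with hfdef
  set c : ℕ → ℝ := fun n => ‖f n‖ ^ 2 with hc
  obtain ⟨L, hL⟩ : ∃ L, Tendsto c atTop (𝓝 L) :=
    ⟨_, tendsto_atTop_ciInf (antitone_norm_walkOp_pow _)
      ⟨0, by rintro _ ⟨n, rfl⟩; positivity⟩⟩
  have hL0 : 0 ≤ L := ge_of_tendsto' hL fun n => by positivity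
  have hdiff : Tendsto (fun n => c n - c (n + 1)) atTop (𝓝 0) := by
    simpa using hL.sub (hL.comp (tendsto_add_atTop_nat 1))
  have hletters : ∀ x y, Tendsto (fun n => displacement (letterVal a x * letterVal a y) (f n))
      atTop (𝓝 0) := by
    intro x y
    have hsq : Tendsto (fun n => displacement (letterVal a x * letterVal a y) (f n) ^ 2)
        atTop (𝓝 0) := by
      refine squeeze_zero (fun n => sq_nonneg _) (fun n => ?_)
        (by simpa using hdiff.const_mul (2 * (2 * (k : ℝ)) ^ 2))
      -- The inverse letter of `x` is inserted so that `y⁻¹x` becomes the plain product of the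
      -- letters `x` and `y`.
      have h := displacement_sq_le (a := a) hk y (x.1, !x.2) (f n)
      rw [letterVal_not, inv_inv] at h
      have hs : walkOp X a (f n) = f (n + 1) := by
        simp only [hfdef, pow_succ', Module.End.mul_apply]
      rwa [hs] at h
    have h := hsq.sqrt
    simpa [Real.sqrt_sq (displacement_nonneg _ _)] using h
  have hinf := infinite_setOf_displacement_tendsto hk ha u hletters
  have hdouble : Tendsto (fun n : ℕ => n + n) atTop atTop :=
    tendsto_atTop_mono (fun n => Nat.le_add_left n n) tendsto_id
  have hle : ∀ m : ℕ, m * L ≤ 1 := by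
    intro m
    obtain ⟨F, hF, rfl⟩ := hinf.exists_subset_card_eq m
    have hv : ∀ v ∈ F, Tendsto (fun n => f (n + n) v) atTop (𝓝 L) := by
      intro v hv
      obtain ⟨g, rfl, hg⟩ := hF hv
      have hz : Tendsto (fun n => f (n + n) (g • u) - f (n + n) u) atTop (𝓝 0) := by
        refine squeeze_zero_norm (fun n => ?_) (hg.comp hdouble)
        have := finsupp_abs_apply_le_norm (translation X g⁻¹ (f (n + n)) - f (n + n)) u
        rw [Finsupp.sub_apply, translation_apply, inv_inv] at this
        rw [Real.norm_eq_abs]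
        exact this.trans_eq (displacement_inv g _)
      have hu : Tendsto (fun n => f (n + n) u) atTop (𝓝 L) := by
        simp only [hfdef, walkOp_return]
        exact hL
      simpa using hz.add hu
    have hsum := tendsto_finsetSum F hv
    rw [Finset.sum_const, nsmul_eq_mul] at hsum
    exact le_of_tendsto' hsum fun n => sum_walkOp_pow_single_le_one a _ u F
  have hLz : L = 0 := by
    by_contra hne
    have hpos : 0 < L := lt_of_le_of_ne hL0 (Ne.symm hne)
    obtain ⟨m, hm⟩ := exists_nat_gt (1 / L)
    rw [div_lt_iff₀ hpos] at hm
    exact absurd (hle m) (not_le.2 hm)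
  rwa [hLz] at hL

theorem tendsto_wordCount_div [Infinite X] [MulAction.IsPretransitive G X]
    (hk : 0 < k) (ha : Generates a) (u v : X) :
    Tendsto (fun n => (wordCount {w | wordVal a w • u = v} n : ℝ) / (2 * (k : ℝ)) ^ n)
      atTop (𝓝 0) := by
  simp only [← walkOp_pow_single]
  have h := (tendsto_norm_walkOp_pow_single hk ha u).sqrt
  simp only [Real.sqrt_sq (norm_nonneg _), Real.sqrt_zero] at h
  exact squeeze_zero_norm (fun n => finsupp_abs_apply_le_norm _ v) h

end Escape

/-! ### Spectral gaps -/

section Gap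

variable {G X : Type*} [Group G] [MulAction G X]

/-- A finite family of group elements moves every finitely supported function by a definite
proportion of its norm. -/
def HasGap (X : Type*) [MulAction G X] {I : Type*} [Fintype I] (g : I → G) : Prop :=
  ∃ ε : ℝ, 0 < ε ∧ ∀ f : X →₀ ℝ, ε * ‖f‖ ^ 2 ≤ ∑ i, displacement (g i) f ^ 2

variable {k : ℕ} {a : Fin k → G}

lemma Generates.exists_displacement_sq_le (ha : Generates a) (X : Type*) [MulAction G X] (g : G) :
    ∃ C : ℝ, 0 ≤ C ∧ ∀ f : X →₀ ℝ,
      displacement g f ^ 2 ≤ C * ∑ x, displacement (letterVal a x) f ^ 2 := by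
  induction g using ha.induction with
  | one => exact ⟨0, le_rfl, fun f => by simp [displacement_one]⟩
  | mul x g ih =>
    obtain ⟨C, hC, h⟩ := ih
    refine ⟨2 + 2 * C, by positivity, fun f => ?_⟩
    have h1 := displacement_mul_le (letterVal a x) g f
    have h2 : displacement (letterVal a x) f ^ 2 ≤ ∑ x, displacement (letterVal a x) f ^ 2 :=
      Finset.single_le_sum (f := fun x => displacement (letterVal a x) f ^ 2)
        (fun _ _ => sq_nonneg _) (Finset.mem_univ x)
    calc displacement (letterVal a x * g) f ^ 2
        ≤ (displacement (letterVal a x) f + displacement g f) ^ 2 :=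
          pow_le_pow_left₀ (displacement_nonneg _ _) h1 2
      _ ≤ 2 * (displacement (letterVal a x) f ^ 2 + displacement g f ^ 2) := add_sq_le
      _ ≤ _ := by linarith [h f]

/-- Each `g i` is a word in the letters, so its squared displacement is bounded by a multiple of
theirs. This gives independence of the generating family. -/
lemma HasGap.of_generates {I : Type*} [Fintype I] {g : I → G} (h : HasGap X g)
    (ha : Generates a) : HasGap X (letterVal a) := by
  obtain ⟨ε, hε, h⟩ := h
  choose C hC hle using fun i => ha.exists_displacement_sq_le X (g i)
  have hS : 0 < 1 + ∑ i, C i := by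
    have := Finset.sum_nonneg fun i (_ : i ∈ Finset.univ) => hC i
    linarith
  refine ⟨ε / (1 + ∑ i, C i), by positivity, fun f => ?_⟩
  have h0 : 0 ≤ ∑ x, displacement (letterVal a x) f ^ 2 := Finset.sum_nonneg fun _ _ => sq_nonneg _
  rw [div_mul_eq_mul_div, div_le_iff₀ hS]
  calc ε * ‖f‖ ^ 2 ≤ ∑ i, displacement (g i) f ^ 2 := h f
    _ ≤ ∑ i, C i * ∑ x, displacement (letterVal a x) f ^ 2 :=
        Finset.sum_le_sum fun i _ => hle i f
    _ = (∑ i, C i) * ∑ x, displacement (letterVal a x) f ^ 2 := by rw [Finset.sum_mul]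
    _ ≤ _ := by linarith

/-- A spectral gap is inherited along finitely many equivariant embeddings that cover `X`. -/
lemma HasGap.of_cover {G' Y I J : Type*} [Group G'] [MulAction G' Y] [Fintype I] [Fintype J]
    {b : J → G'} (h : HasGap Y b) {ι : I → Y → X} (hι : ∀ i, Function.Injective (ι i))
    (hcov : ∀ x, ∃ i y, ι i y = x) (g : I × J → G)
    (heq : ∀ i j y, ι i (b j • y) = g (i, j) • ι i y) : HasGap X g := by
  obtain ⟨ε, hε, h⟩ := h
  refine ⟨ε, hε, fun f => ?_⟩
  have hdisp : ∀ i j, displacement (b j) (f.comapDomain (ι i) (hι i).injOn) ≤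
      displacement (g (i, j)) f := by
    intro i j
    -- A translation by `g` evaluates at `g⁻¹ • x`; passing to inverses makes `heq` applicable as
    -- stated.
    rw [← displacement_inv (b j), ← displacement_inv (g (i, j))]
    have : translation Y (b j)⁻¹ (f.comapDomain (ι i) (hι i).injOn) -
        f.comapDomain (ι i) (hι i).injOn =
        (translation X (g (i, j))⁻¹ f - f).comapDomain (ι i) (hι i).injOn := by
      ext y
      simp [translation_apply, heq]
    unfold displacement
    rw [this]
    exact finsupp_norm_comapDomain_le (hι i) _
  calc ε * ‖f‖ ^ 2 ≤ ε * ∑ i, ‖f.comapDomain (ι i) (hι i).injOn‖ ^ 2 := by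
        gcongr
        exact finsupp_norm_sq_le_sum_comapDomain hι hcov f
    _ = ∑ i, ε * ‖f.comapDomain (ι i) (hι i).injOn‖ ^ 2 := by rw [Finset.mul_sum]
    _ ≤ ∑ i, ∑ j, displacement (b j) (f.comapDomain (ι i) (hι i).injOn) ^ 2 :=
        Finset.sum_le_sum fun i _ => h _
    _ ≤ ∑ i, ∑ j, displacement (g (i, j)) f ^ 2 :=
        Finset.sum_le_sum fun i _ => Finset.sum_le_sum fun j _ =>
          pow_le_pow_left₀ (displacement_nonneg _ _) (hdisp i j) 2
    _ = _ := (Fintype.sum_prod_type fun z => displacement (g z) f ^ 2).symm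

/-! #### From exponential decay to a gap -/

lemma walkOp_pow_single_symm (n : ℕ) (u v : X) :
    ((walkOp X a) ^ n) (Finsupp.single u 1) v = ((walkOp X a) ^ n) (Finsupp.single v 1) u := by
  rw [← finsupp_inner_single, (walkOp_isSymmetric a).pow n, real_inner_comm, finsupp_inner_single]

/-- Moving the endpoint by one letter costs one step of the walk and a factor `2 * k`. -/
lemma walkOp_pow_single_decay_right (hk : 0 < k) [MulAction.IsPretransitive G X]
    (ha : Generates a) {σ : ℝ} (v u : X)
    (h : ∃ C : ℝ, ∀ n, ((walkOp X a) ^ n) (Finsupp.single v 1) u ≤ C * σ ^ n) (u' : X) :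
    ∃ C : ℝ, ∀ n, ((walkOp X a) ^ n) (Finsupp.single v 1) u' ≤ C * σ ^ n := by
  have hk' : (0 : ℝ) < k := by exact_mod_cast hk
  obtain ⟨g, rfl⟩ := MulAction.exists_smul_eq G u u'
  induction g using ha.induction with
  | one => simpa using h
  | mul x g ih =>
    obtain ⟨C, hC⟩ := ih
    refine ⟨2 * k * (C * σ), fun n => ?_⟩
    have h1 := hC (n + 1)
    rw [pow_succ', Module.End.mul_apply, walkOp_apply, sum_letters_inv a fun h =>
      ((walkOp X a) ^ n) (Finsupp.single v 1) (h • g • u), inv_mul_le_iff₀ (by positivity)] at h1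
    have h2 := Finset.single_le_sum (f := fun x =>
      ((walkOp X a) ^ n) (Finsupp.single v 1) (letterVal a x • g • u))
      (fun _ _ => walkOp_pow_single_nonneg a _ _ _) (Finset.mem_univ x)
    rw [mul_smul]
    refine (h2.trans h1).trans_eq ?_
    ring

/-- Symmetry lets the starting point be moved like the endpoint, and bilinearity spreads the bound
from point masses to all functions. The constant depends on `f` and `g`, the rate does not. -/
lemma walkOp_pow_decay (hk : 0 < k) [MulAction.IsPretransitive G X] (ha : Generates a) {σ : ℝ}
    (o : X) (h : ∃ C : ℝ, ∀ n, ((walkOp X a) ^ n) (Finsupp.single o 1) o ≤ C * σ ^ n)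
    (f g : X →₀ ℝ) : ∃ C : ℝ, ∀ n, |inner ℝ (((walkOp X a) ^ n) f) g| ≤ C * σ ^ n := by
  have hpt : ∀ u v : X, ∃ C : ℝ, ∀ n, ((walkOp X a) ^ n) (Finsupp.single u 1) v ≤ C * σ ^ n := by
    intro u v
    refine walkOp_pow_single_decay_right hk ha u o ?_ v
    simp only [walkOp_pow_single_symm _ u]
    exact walkOp_pow_single_decay_right hk ha o o h u
  induction f using Finsupp.induction_linear with
  | zero => exact ⟨0, fun n => by simp⟩
  | add f f' hf hf' =>
    obtain ⟨C, hC⟩ := hf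
    obtain ⟨C', hC'⟩ := hf'
    refine ⟨C + C', fun n => ?_⟩
    rw [map_add, inner_add_left, add_mul]
    exact (abs_add_le _ _).trans (add_le_add (hC n) (hC' n))
  | single u s =>
    induction g using Finsupp.induction_linear with
    | zero => exact ⟨0, fun n => by simp⟩
    | add f f' hf hf' =>
      obtain ⟨C, hC⟩ := hf
      obtain ⟨C', hC'⟩ := hf'
      refine ⟨C + C', fun n => ?_⟩
      rw [inner_add_right, add_mul]
      exact (abs_add_le _ _).trans (add_le_add (hC n) (hC' n))
    | single v t =>
      obtain ⟨C, hC⟩ := hpt u v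
      refine ⟨|s| * |t| * C, fun n => ?_⟩
      rw [← Finsupp.smul_single_one u s, ← Finsupp.smul_single_one v t, map_smul,
        real_inner_smul_left, real_inner_smul_right, finsupp_inner_single, abs_mul, abs_mul,
        abs_of_nonneg (walkOp_pow_single_nonneg a n u v), ← mul_assoc, mul_assoc _ C]
      exact mul_le_mul_of_nonneg_left (hC n) (by positivity)

/-- A log-convex sequence that decays like `ρ ^ n` decays by the factor `ρ` in its first step. -/
lemma le_mul_of_logConvex {c : ℕ → ℝ} (hc : ∀ n, 0 ≤ c n)
    (hlog : ∀ n, c (n + 1) ^ 2 ≤ c n * c (n + 2)) {C ρ : ℝ} (hρ : 0 < ρ)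
    (hle : ∀ n, c n ≤ C * ρ ^ n) : c 1 ≤ ρ * c 0 := by
  by_contra! hlt
  have h1 : 0 < c 1 := lt_of_le_of_lt (mul_nonneg hρ.le (hc 0)) hlt
  have h0 : 0 < c 0 := by
    refine lt_of_le_of_ne (hc 0) fun h => ?_
    have := hlog 0
    rw [← h, zero_mul] at this
    nlinarith
  -- Log-convexity makes successive ratios nondecreasing, so `c n ≥ c 0 * q ^ n`; with `q > ρ` this
  -- outgrows `C * ρ ^ n`.
  set q := c 1 / c 0 with hq
  have hq0 : 0 < q := by positivity
  have hstep : ∀ n, 0 < c n ∧ q * c n ≤ c (n + 1) := by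
    intro n
    induction n with
    | zero => exact ⟨h0, by rw [hq, div_mul_cancel₀ _ h0.ne']⟩
    | succ n ih =>
      have hpos : 0 < c (n + 1) := lt_of_lt_of_le (mul_pos hq0 ih.1) ih.2
      refine ⟨hpos, le_of_mul_le_mul_left ?_ ih.1⟩
      calc c n * (q * c (n + 1)) = (q * c n) * c (n + 1) := by ring
        _ ≤ c (n + 1) * c (n + 1) := by gcongr; exact ih.2
        _ = c (n + 1) ^ 2 := by ring
        _ ≤ _ := hlog n
  have hpow : ∀ n, c 0 * q ^ n ≤ c n := by
    intro n
    induction n with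
    | zero => simp
    | succ n ih =>
      calc c 0 * q ^ (n + 1) = q * (c 0 * q ^ n) := by ring
        _ ≤ q * c n := by gcongr
        _ ≤ _ := (hstep n).2
  have hqρ : 1 < q / ρ := by
    rw [one_lt_div hρ, hq, lt_div_iff₀ h0]
    exact hlt
  obtain ⟨n, hn⟩ := pow_unbounded_of_one_lt (C / c 0) hqρ
  have h2 := (hpow n).trans (hle n)
  rw [div_pow, lt_div_iff₀ (by positivity), div_mul_eq_mul_div, div_lt_iff₀ h0] at hn
  linarith

/-- Here the constant depending on `f` disappears: `‖Pⁿf‖²` is log-convex by Cauchy–Schwarz, so its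
asymptotic rate already bounds its first step. -/
lemma norm_sq_walkOp_le_of_decay (hk : 0 < k) [MulAction.IsPretransitive G X] (ha : Generates a)
    {σ : ℝ} (hσ : 0 < σ) (o : X)
    (h : ∃ C : ℝ, ∀ n, ((walkOp X a) ^ n) (Finsupp.single o 1) o ≤ C * σ ^ n) (f : X →₀ ℝ) :
    ‖walkOp X a f‖ ^ 2 ≤ σ ^ 2 * ‖f‖ ^ 2 := by
  obtain ⟨C, hC⟩ := walkOp_pow_decay hk ha o h f f
  have := le_mul_of_logConvex (c := fun n => ‖((walkOp X a) ^ n) f‖ ^ 2) (fun n => by positivity)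
    (fun n => ?_) (C := C) (ρ := σ ^ 2) (by positivity) (fun n => ?_)
  · simpa using this
  · have h1 : ‖((walkOp X a) ^ (n + 1)) f‖ ^ 2 =
        inner ℝ (((walkOp X a) ^ n) f) (((walkOp X a) ^ (n + 2)) f) := by
      rw [← real_inner_self_eq_norm_sq, inner_walkOp_pow, inner_walkOp_pow]
      congr 3
      omega
    have h2 := real_inner_le_norm (((walkOp X a) ^ n) f) (((walkOp X a) ^ (n + 2)) f)
    rw [← h1] at h2
    rw [← mul_pow]
    exact pow_le_pow_left₀ (by positivity) h2 2
  · rw [← real_inner_self_eq_norm_sq, inner_walkOp_pow, ← pow_mul, two_mul]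
    exact (le_abs_self _).trans (hC _)

lemma hasGap_of_decay (hk : 0 < k) [MulAction.IsPretransitive G X] (ha : Generates a)
    {σ : ℝ} (hσ : 0 < σ) (hσ1 : σ < 1) (o : X)
    (h : ∃ C : ℝ, ∀ n, ((walkOp X a) ^ n) (Finsupp.single o 1) o ≤ C * σ ^ n) :
    HasGap X (letterVal a) := by
  have hk' : (0 : ℝ) < k := by exact_mod_cast hk
  refine ⟨2 * (2 * k) * (1 - σ), mul_pos (by positivity) (by linarith), fun f => ?_⟩
  rw [sum_displacement_sq a hk, mul_assoc (2 * (2 * (k : ℝ)))]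
  refine mul_le_mul_of_nonneg_left ?_ (by positivity)
  have h1 : ‖walkOp X a f‖ ≤ σ * ‖f‖ := by
    refine (sq_le_sq₀ (norm_nonneg _) (by positivity)).1 ?_
    rw [mul_pow]
    exact norm_sq_walkOp_le_of_decay hk ha hσ o h f
  have h2 := real_inner_le_norm (walkOp X a f) f
  nlinarith [norm_nonneg f]

/-! #### From a gap to exponential decay -/

/-- `P` has nonnegative coefficients. A gap bounds the quadratic form only from above; this also
bounds it from below and so excludes spectrum near `-1`. -/
lemma abs_inner_walkOp_le (f : X →₀ ℝ) :
    |inner ℝ (walkOp X a f) f| ≤ inner ℝ (walkOp X a (f.mapRange (fun c => |c|) abs_zero))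
      (f.mapRange (fun c => |c|) abs_zero) := by
  rw [inner_walkOp, inner_walkOp, abs_mul, abs_of_nonneg (by positivity)]
  refine mul_le_mul_of_nonneg_left ?_ (by positivity)
  refine (Finset.abs_sum_le_sum_abs _ _).trans (Finset.sum_le_sum fun x _ => ?_)
  rw [real_inner_comm, real_inner_comm (f.mapRange _ _),
    finsupp_inner_eq_sum f _ subset_rfl,
    finsupp_inner_eq_sum (f.mapRange _ _) _ (Finsupp.support_mapRange (hf := abs_zero))]
  refine (Finset.abs_sum_le_sum_abs _ _).trans_eq (Finset.sum_congr rfl fun v _ => ?_)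
  simp [translation_apply, abs_mul]

/-- Polarisation: subtracting the bounds at `f + g` and `f - g` isolates `4⟨Tf, g⟩`, and `g = M⁻¹Tf`
turns this into `‖Tf‖²`. -/
lemma norm_le_of_abs_inner_le {E : Type*} [SeminormedAddCommGroup E] [InnerProductSpace ℝ E]
    {T : E →ₗ[ℝ] E} (hT : T.IsSymmetric) {M : ℝ} (hM : 0 < M)
    (h : ∀ f, |inner ℝ (T f) f| ≤ M * ‖f‖ ^ 2) (f : E) : ‖T f‖ ≤ M * ‖f‖ := by
  set g : E := M⁻¹ • T f with hg
  have h1 := (abs_le.1 (h (f + g))).2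
  have h2 := (abs_le.1 (h (f - g))).1
  have h3 : inner ℝ (T g) f = inner ℝ (T f) g := by rw [hT, real_inner_comm]
  have h4 : inner ℝ (T f) g = M⁻¹ * ‖T f‖ ^ 2 := by
    rw [hg, real_inner_smul_right, real_inner_self_eq_norm_sq]
  have h5 : ‖g‖ ^ 2 = M⁻¹ ^ 2 * ‖T f‖ ^ 2 := by
    rw [hg, norm_smul, mul_pow, Real.norm_of_nonneg (by positivity)]
  rw [map_add, inner_add_left, inner_add_right, inner_add_right, h3, h4,
    norm_add_sq_real, h5] at h1
  rw [map_sub, inner_sub_left, inner_sub_right, inner_sub_right, h3, h4,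
    norm_sub_sq_real, h5] at h2
  refine (sq_le_sq₀ (norm_nonneg _) (by positivity)).1 ?_
  have h6 : 4 * (M⁻¹ * ‖T f‖ ^ 2) ≤ M * (2 * ‖f‖ ^ 2 + 2 * (M⁻¹ ^ 2 * ‖T f‖ ^ 2)) := by linarith
  have h7 : M * (4 * (M⁻¹ * ‖T f‖ ^ 2)) = 4 * ‖T f‖ ^ 2 := by field_simp
  have h8 : M * (M * (2 * ‖f‖ ^ 2 + 2 * (M⁻¹ ^ 2 * ‖T f‖ ^ 2))) =
      2 * M ^ 2 * ‖f‖ ^ 2 + 2 * ‖T f‖ ^ 2 := by field_simp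
  have h9 := mul_le_mul_of_nonneg_left h6 hM.le
  rw [h7, h8] at h9
  nlinarith

lemma HasGap.exists_decay (hk : 0 < k) (h : HasGap X (letterVal a)) :
    ∃ σ : ℝ, 0 < σ ∧ σ < 1 ∧ ∀ n (u v : X),
      ((walkOp X a) ^ n) (Finsupp.single u 1) v ≤ σ ^ n := by
  have hk' : (0 : ℝ) < k := by exact_mod_cast hk
  obtain ⟨ε, hε, h⟩ := h
  -- The `1 / 2` only ensures `0 < M`, which division by `M` requires.
  set M : ℝ := max (1 - ε / (2 * (2 * k))) (1 / 2) with hM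
  have hM0 : 0 < M := lt_of_lt_of_le (by norm_num) (le_max_right _ _)
  have hM1 : M < 1 := max_lt (by have : 0 < ε / (2 * (2 * k)) := by positivity
                                 linarith) (by norm_num)
  have hform : ∀ f : X →₀ ℝ, inner ℝ (walkOp X a f) f ≤ M * ‖f‖ ^ 2 := by
    intro f
    have h1 := h f
    rw [sum_displacement_sq a hk] at h1
    have h2 : ε / (2 * (2 * k)) * ‖f‖ ^ 2 ≤ ‖f‖ ^ 2 - inner ℝ (walkOp X a f) f := by
      rw [div_mul_eq_mul_div, div_le_iff₀ (by positivity)]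
      linarith
    have h3 : (1 - ε / (2 * (2 * k))) * ‖f‖ ^ 2 ≤ M * ‖f‖ ^ 2 := by
      gcongr
      exact le_max_left _ _
    linarith
  have hnorm : ∀ f : X →₀ ℝ, ‖walkOp X a f‖ ≤ M * ‖f‖ :=
    norm_le_of_abs_inner_le (walkOp_isSymmetric a) hM0 fun f => (abs_inner_walkOp_le f).trans
      ((hform _).trans_eq (by rw [finsupp_norm_mapRange_abs]))
  refine ⟨M, hM0, hM1, fun n u v => (le_abs_self _).trans
    ((finsupp_abs_apply_le_norm _ v).trans ?_)⟩
  induction n with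
  | zero => simp [finsupp_norm_single]
  | succ n ih =>
    rw [pow_succ' (walkOp X a), Module.End.mul_apply, pow_succ']
    exact (hnorm _).trans (by gcongr)

end Gap

/-! ### Amenability of Schreier graphs and decay of the walk -/

section Schreier

variable {G : Type*} [Group G] {k : ℕ} {a : Fin k → G} (H : Subgroup G)

lemma pathEnd_mk (a : Fin k → G) (g : G) (p : List (Fin k × Bool)) :
    pathEnd H a (Quotient.mk'' g) p = Quotient.mk'' (g * wordVal a p) := by
  induction p generalizing g with
  | nil => simp [pathEnd, wordVal_nil]
  | cons x p ih =>
    rw [wordVal_cons, ← mul_assoc, ← ih]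
    rfl

lemma smul_mk_one_eq_iff {H : Subgroup G} {g : G} :
    g • ((1 : G) : G ⧸ H) = ((1 : G) : G ⧸ H) ↔ g ∈ H := by
  rw [← MulAction.mem_stabilizer_iff, MulAction.stabilizer_quotient]

/-- Right cosets are traded for the left action on `G ⧸ H`: a label closes up at the base vertex on
either side exactly when its value lies in `H`. -/
lemma closedPaths_eq (a : Fin k → G) (n : ℕ) :
    closedPaths H a n =
      wordCount {w | wordVal a w • ((1 : G) : G ⧸ H) = ((1 : G) : G ⧸ H)} n := by
  unfold closedPaths wordCount
  congr 1
  ext w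
  simp only [Set.mem_ofPred_eq, smul_mk_one_eq_iff, pathEnd_mk, one_mul]
  rw [Quotient.eq'', QuotientGroup.rightRel_apply]
  simp

lemma closedPaths_div (a : Fin k → G) (n : ℕ) :
    (closedPaths H a n : ℝ) / (2 * (k : ℝ)) ^ n =
      ((walkOp (G ⧸ H) a) ^ n) (Finsupp.single ((1 : G) : G ⧸ H) 1) ((1 : G) : G ⧸ H) := by
  rw [walkOp_pow_single, closedPaths_eq]

lemma closedPaths_le (a : Fin k → G) (n : ℕ) : (closedPaths H a n : ℝ) ≤ (2 * (k : ℝ)) ^ n := by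
  rw [closedPaths_eq]
  have := wordCount_le {w | wordVal a w • ((1 : G) : G ⧸ H) = ((1 : G) : G ⧸ H)} n
  have h : ((Fintype.card (Fin k × Bool) : ℕ) : ℝ) = 2 * k := by simp [mul_comm]
  rw [← h]
  exact_mod_cast this

variable {H}

lemma root_closedPaths_le {s : ℝ} (hs : 0 ≤ s) {n : ℕ} (hn : n ≠ 0)
    (h : (closedPaths H a n : ℝ) ≤ s ^ n) : (closedPaths H a n : ℝ) ^ (1 / (n : ℝ)) ≤ s := by
  rw [one_div, Real.rpow_inv_le_iff_of_pos (by positivity) hs (by positivity), Real.rpow_natCast]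
  exact h

lemma limsup_root_closedPaths_le {s : ℝ} (hs : 0 ≤ s)
    (h : ∀ n, (closedPaths H a n : ℝ) ≤ s ^ n) :
    limsup (fun n : ℕ => (closedPaths H a n : ℝ) ^ (1 / (n : ℝ))) atTop ≤ s := by
  refine limsup_le_of_le ?_ ?_
  · exact IsBoundedUnder.isCoboundedUnder_le ⟨0, by simpa using ⟨0, fun n _ => by positivity⟩⟩
  · filter_upwards [eventually_ne_atTop 0] with n hn
    exact root_closedPaths_le hs hn (h n)

lemma exists_decay_of_not_schreierAmenable (hk : 0 < k) (h : ¬ SchreierAmenable H a) :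
    ∃ σ : ℝ, 0 < σ ∧ σ < 1 ∧ ∃ C : ℝ, ∀ n, ((walkOp (G ⧸ H) a) ^ n)
      (Finsupp.single ((1 : G) : G ⧸ H) 1) ((1 : G) : G ⧸ H) ≤ C * σ ^ n := by
  have hk' : (0 : ℝ) < 2 * k := by positivity
  set L := limsup (fun n : ℕ => (closedPaths H a n : ℝ) ^ (1 / (n : ℝ))) atTop with hL
  have hle : L ≤ 2 * k := limsup_root_closedPaths_le hk'.le (closedPaths_le H a)
  have hlt : L < 2 * k := by
    refine lt_of_le_of_ne hle fun heq => h ?_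
    rw [SchreierAmenable, spectralRadius, ← hL, heq, div_self hk'.ne']
  -- The maximum with 0 makes `s` positive; the decay rate will be `s / (2 * k)`.
  obtain ⟨s, hs, hs2⟩ := exists_between (max_lt hlt hk')
  have hs0 : 0 < s := (le_max_right _ _).trans_lt hs
  have hbdd : IsBoundedUnder (· ≤ ·) atTop
      fun n : ℕ => (closedPaths H a n : ℝ) ^ (1 / (n : ℝ)) := by
    refine ⟨2 * k, ?_⟩
    rw [eventually_map]
    filter_upwards [eventually_ne_atTop 0] with n hn
    exact root_closedPaths_le hk'.le hn (closedPaths_le H a n)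
  have hev : ∀ᶠ n : ℕ in atTop, (closedPaths H a n : ℝ) / s ^ n ≤ 1 := by
    filter_upwards [eventually_lt_of_limsup_lt ((le_max_left _ _).trans_lt hs) hbdd,
      eventually_ne_atTop 0] with n hn hn0
    rw [div_le_one (by positivity), ← Real.rpow_natCast,
      ← Real.rpow_inv_le_iff_of_pos (by positivity) hs0.le (by positivity), ← one_div]
    exact hn.le
  -- The finitely many exceptional lengths are absorbed into `C`.
  obtain ⟨C, hC⟩ := (show IsBoundedUnder (· ≤ ·) atTop
    fun n : ℕ => (closedPaths H a n : ℝ) / s ^ n from ⟨1, hev⟩).bddAbove_range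
  refine ⟨s / (2 * k), by positivity, (div_lt_one hk').2 hs2, C, fun n => ?_⟩
  rw [← closedPaths_div, div_pow, ← mul_div_assoc]
  gcongr
  rw [← div_le_iff₀ (by positivity)]
  exact hC ⟨n, rfl⟩

lemma not_schreierAmenable_of_hasGap (hk : 0 < k) (h : HasGap (G ⧸ H) (letterVal a)) :
    ¬ SchreierAmenable H a := by
  have hk' : (0 : ℝ) < 2 * k := by positivity
  obtain ⟨σ, hσ0, hσ1, hσ⟩ := h.exists_decay hk
  have hle := limsup_root_closedPaths_le (H := H) (a := a) (s := σ * (2 * k)) (by positivity)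
    fun n => by
      have := hσ n ((1 : G) : G ⧸ H) ((1 : G) : G ⧸ H)
      rw [← closedPaths_div, div_le_iff₀ (by positivity), ← mul_pow] at this
      exact this
  refine ne_of_lt (lt_of_le_of_lt ?_ hσ1)
  rwa [spectralRadius, div_le_iff₀ hk']

lemma hasGap_of_not_schreierAmenable (hk : 0 < k) (ha : Generates a)
    (h : ¬ SchreierAmenable H a) : HasGap (G ⧸ H) (letterVal a) := by
  obtain ⟨σ, hσ0, hσ1, hσ⟩ := exists_decay_of_not_schreierAmenable hk h
  exact hasGap_of_decay hk ha hσ0 hσ1 _ hσ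

end Schreier

/-! ### Passing to a finite index subgroup and a quotient -/

section Reduction

variable {G Gbar : Type*} [Group G] [Group Gbar] {G₁ : Subgroup G}

/-- The preimage of `K` under `φ : G₁ → Gbar`, as a subgroup of `G`. -/
def preimage (φ : G₁ →* Gbar) (K : Subgroup Gbar) : Subgroup G :=
  (K.comap φ).map G₁.subtype

lemma mem_preimage {φ : G₁ →* Gbar} {K : Subgroup Gbar} (g : G₁) :
    (g : G) ∈ preimage φ K ↔ φ g ∈ K := by
  simp [preimage]

lemma infinite_quotient_preimage {φ : G₁ →* Gbar} (hφ : Function.Surjective φ)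
    {K : Subgroup Gbar} (hK : K.index = 0) : Infinite (G ⧸ preimage φ K) := by
  have h : (preimage φ K).index = 0 := by
    rw [preimage, Subgroup.index_map_subtype, Subgroup.index_comap_of_surjective K hφ, hK,
      zero_mul]
  rw [Subgroup.index, Nat.card_eq_zero] at h
  exact h.resolve_left (not_isEmpty_of_nonempty _)

lemma exists_transversal (G₁ : Subgroup G) :
    ∃ r : G ⧸ G₁ → G, (∀ s, (r s : G ⧸ G₁) = s) ∧ r ((1 : G) : G ⧸ G₁) = 1 := by
  -- Right multiplication by an element of `G₁` normalises the base representative without changing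
  -- any coset.
  refine ⟨fun s => s.out * (((1 : G) : G ⧸ G₁).out)⁻¹, fun s => ?_, mul_inv_cancel _⟩
  have h1 : (((1 : G) : G ⧸ G₁).out)⁻¹ ∈ G₁ := by
    have := QuotientGroup.out_eq' ((1 : G) : G ⧸ G₁)
    rw [QuotientGroup.eq, mul_one] at this
    exact this
  rw [QuotientGroup.mk_mul_of_mem _ h1]
  exact QuotientGroup.out_eq' s

/-- `G ⧸ L` is the union of the finitely many pieces `r s · (G₁ / L)`, each a copy of `Gbar ⧸ K`. On
the piece of `s`, the conjugate by `r s` of a lift of `b j` acts as `b j`. -/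
lemma HasGap.preimage [G₁.FiniteIndex] {φ : G₁ →* Gbar} (hφ : Function.Surjective φ)
    {K : Subgroup Gbar} {J : Type*} [Fintype J] {b : J → Gbar} (h : HasGap (Gbar ⧸ K) b)
    {k : ℕ} {a : Fin k → G} (ha : Generates a) :
    HasGap (G ⧸ preimage φ K) (letterVal a) := by
  classical
  obtain ⟨r, hr, -⟩ := exists_transversal G₁
  have : Fintype (G ⧸ G₁) := Fintype.ofFinite _
  set ψ : Gbar → G₁ := Function.surjInv hφ
  have hψ : ∀ x, φ (ψ x) = x := Function.surjInv_eq hφ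
  let ι : G ⧸ G₁ → Gbar ⧸ K → G ⧸ GenericCase.preimage φ K :=
    fun s y => ((r s * ψ y.out : G) : G ⧸ GenericCase.preimage φ K)
  -- One equivalence serves twice: left to right for injectivity of `ι s`, right to left for
  -- independence of chosen lifts.
  have hmk : ∀ s (g g' : G₁), ((r s * g : G) : G ⧸ GenericCase.preimage φ K) =
      ((r s * g' : G) : G ⧸ GenericCase.preimage φ K) ↔
      ((φ g : Gbar) : Gbar ⧸ K) = ((φ g' : Gbar) : Gbar ⧸ K) := by
    intro s g g'
    rw [QuotientGroup.eq, QuotientGroup.eq, ← map_inv, ← map_mul, ← mem_preimage]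
    simp [mul_assoc]
  refine HasGap.of_generates (HasGap.of_cover h (ι := ι) (fun s y y' hy => ?_) (fun x => ?_)
    (fun z => r z.1 * ψ (b z.2) * (r z.1)⁻¹) fun s j y => ?_) ha
  · have := (hmk s _ _).1 hy
    rw [hψ, hψ] at this
    simpa using this
  · induction x using QuotientGroup.induction_on with
    | H g =>
      have hg : (r (g : G ⧸ G₁))⁻¹ * g ∈ G₁ := QuotientGroup.eq.1 (hr _)
      refine ⟨(g : G ⧸ G₁), ((φ ⟨_, hg⟩ : Gbar) : Gbar ⧸ K), ?_⟩
      have := (hmk (g : G ⧸ G₁) (ψ (((φ ⟨_, hg⟩ : Gbar) : Gbar ⧸ K)).out) ⟨_, hg⟩).2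
        (by rw [hψ]; exact QuotientGroup.out_eq' _)
      simpa [ι] using this
  · have := (hmk s (ψ (b j • y).out) (ψ (b j) * ψ y.out)).2 (by
      rw [map_mul, hψ, hψ, hψ, QuotientGroup.out_eq']
      change _ = b j • ((y.out : Gbar) : Gbar ⧸ K)
      rw [QuotientGroup.out_eq'])
    simp only [ι]
    rw [this]
    change _ = (((r s * ψ (b j) * (r s)⁻¹) * (r s * ψ y.out) : G) : G ⧸ GenericCase.preimage φ K)
    simp [mul_assoc]

/-- The Schreier cocycle of a transversal. -/
def cocycle {r : G ⧸ G₁ → G} (hr : ∀ s, (r s : G ⧸ G₁) = s) (s : G ⧸ G₁) (g : G) : G₁ :=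
  ⟨(r s)⁻¹ * g * r (g⁻¹ • s), by
    rw [mul_assoc, ← QuotientGroup.eq, hr]
    change s = g • ((r (g⁻¹ • s) : G) : G ⧸ G₁)
    rw [hr, smul_inv_smul]⟩

lemma cocycle_one {r : G ⧸ G₁ → G} (hr : ∀ s, (r s : G ⧸ G₁) = s) (s : G ⧸ G₁) :
    cocycle hr s 1 = 1 := by
  ext; simp [cocycle]

/-- This identity permits rewriting letter by letter, with the coset as state; since `x` acts on
cosets by a permutation, the automaton is reversible. -/
lemma cocycle_mul {r : G ⧸ G₁ → G} (hr : ∀ s, (r s : G ⧸ G₁) = s) (s : G ⧸ G₁) (g h : G) :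
    cocycle hr s (g * h) = cocycle hr s g * cocycle hr (g⁻¹ • s) h := by
  ext
  simp [cocycle, mul_assoc, mul_smul]

lemma cocycle_of_mem {r : G ⧸ G₁ → G} (hr : ∀ s, (r s : G ⧸ G₁) = s)
    (hr1 : r ((1 : G) : G ⧸ G₁) = 1) {g : G} (hg : g ∈ G₁) :
    cocycle hr ((1 : G) : G ⧸ G₁) g = ⟨g, hg⟩ := by
  have h1 : g⁻¹ • ((1 : G) : G ⧸ G₁) = ((1 : G) : G ⧸ G₁) :=
    smul_mk_one_eq_iff.2 (inv_mem hg)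
  ext
  simp only [cocycle]
  rw [h1, hr1, inv_one, one_mul, mul_one]

/-- Schreier rewriting is performed by a reversible transducer. -/
lemma exists_schreier_transducer [G₁.FiniteIndex] {φ : G₁ →* Gbar} (hφ : Function.Surjective φ)
    {k : ℕ} {a : Fin k → G} (ha : Generates a) {r : G ⧸ G₁ → G}
    (hr : ∀ s, (r s : G ⧸ G₁) = s) (hr1 : r ((1 : G) : G ⧸ G₁) = 1) :
    ∃ (m : ℕ) (b : Fin m → Gbar) (T : Transducer (Fin k × Bool) (Fin m × Bool)), Generates b ∧
      ∀ w, wordVal b (T.output T.start w) = φ (cocycle hr ((1 : G) : G ⧸ G₁) (wordVal a w)) := by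
  let e := Finite.equivFin (G ⧸ G₁)
  let e' := Fintype.equivFin (Fin (Nat.card (G ⧸ G₁)) × (Fin k × Bool))
  let b : Fin (Fintype.card (Fin (Nat.card (G ⧸ G₁)) × (Fin k × Bool))) → Gbar := fun i =>
    φ (cocycle hr (e.symm (e'.symm i).1) (letterVal a (e'.symm i).2))
  let T : Transducer (Fin k × Bool)
      (Fin (Fintype.card (Fin (Nat.card (G ⧸ G₁)) × (Fin k × Bool))) × Bool) :=
    { S := Fin (Nat.card (G ⧸ G₁))
      finiteS := inferInstance
      start := e ((1 : G) : G ⧸ G₁)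
      next := fun s x => e ((letterVal a x)⁻¹ • e.symm s)
      prev := fun s x => e (letterVal a x • e.symm s)
      -- There is one generator for each pair of state and letter, so inverse letters are never
      -- output.
      out := fun s x => (e' (s, x), true)
      prev_next := fun s x => by simp }
  have hout : ∀ w s, wordVal b (T.output (e s) w) = φ (cocycle hr s (wordVal a w)) := by
    intro w
    induction w with
    | nil =>
      intro s
      rw [wordVal_nil, cocycle_one, map_one]
      rfl
    | cons x w ih =>
      intro s
      have hn : T.next (e s) x = e ((letterVal a x)⁻¹ • s) := by simp [T]
      have hl : letterVal b (T.out (e s) x) = φ (cocycle hr s (letterVal a x)) := by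
        simp [T, letterVal, b]
      rw [Transducer.output, wordVal_cons, hn, ih, hl, wordVal_cons, cocycle_mul, map_mul]
  refine ⟨_, b, T, ?_, fun w => hout w _⟩
  rw [Generates, eq_top_iff]
  rintro x -
  -- The family `b` generates because rewriting a word for `g ∈ G₁` from the base coset expresses `φ
  -- g` in it.
  obtain ⟨g, rfl⟩ := hφ x
  obtain ⟨w, hw⟩ := ha.exists_word (g : G)
  have hg : cocycle hr ((1 : G) : G ⧸ G₁) (wordVal a w) = g := by
    rw [hw, cocycle_of_mem hr hr1 g.2]
  rw [← hg, ← hout w]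
  refine list_prod_mem fun y hy => ?_
  obtain ⟨z, -, rfl⟩ := List.mem_map.1 hy
  unfold letterVal
  split_ifs
  · exact Subgroup.subset_closure ⟨_, rfl⟩
  · exact inv_mem (Subgroup.subset_closure ⟨_, rfl⟩)

/-- A partial algorithm for the membership problem that succeeds outside finitely many cosets of
the preimage of `K`. -/
lemma exists_partial_algorithm [G₁.FiniteIndex] {H : Subgroup G} (hH : H ≤ G₁)
    {φ : G₁ →* Gbar} (hφ : Function.Surjective φ) {K : Subgroup Gbar}
    (hHK : (H.subgroupOf G₁).map φ ≤ K) {C : ComplexityClass} (hC : MembershipIn C K)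
    {k : ℕ} {a : Fin k → G} (ha : Generates a) :
    ∃ (M : Machine (Fin k × Bool)) (S : Set (List (Fin k × Bool)))
      (v : G ⧸ G₁ → G ⧸ preimage φ K), C.AllowsMode M ∧ CorrectFor M (MP H a) ∧
      C.DecidesOn M S ∧ Sᶜ ⊆ ⋃ s, {w | wordVal a w • v s = ((1 : G) : G ⧸ preimage φ K)} := by
  obtain ⟨r, hr, hr1⟩ := exists_transversal G₁
  obtain ⟨m, b, T, hb, hT⟩ := exists_schreier_transducer hφ ha hr hr1
  obtain ⟨M, hmode, hcor, hdec⟩ := (hC m b hb).exists_pullback T (E := MP H a) fun w hw => by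
    change wordVal b _ ∈ K
    have hw1 : wordVal a w ∈ G₁ := hH hw
    rw [hT, cocycle_of_mem hr hr1 hw1]
    exact hHK ⟨_, hw, rfl⟩
  refine ⟨M, _, fun s => r s • ((1 : G) : G ⧸ preimage φ K), hmode, hcor, hdec, fun w hw => ?_⟩
  have hw' : wordVal b (T.output T.start w) ∈ K := not_not.1 hw
  rw [hT, ← mem_preimage] at hw'
  -- For an undecided `w`, the product `w · r s` with `s = w⁻¹G₁` lies in `L`, so `w` carries `r s
  -- L` to the base point.
  refine Set.mem_iUnion.2 ⟨(wordVal a w)⁻¹ • ((1 : G) : G ⧸ G₁), ?_⟩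
  change wordVal a w • r _ • _ = _
  rw [← mul_smul, smul_mk_one_eq_iff]
  simpa [cocycle, hr1] using hw'

end Reduction

end GenericCase

/-! ### Estimating the undecided words. -/

open GenericCase in
theorem theoremB {G Gbar : Type*} [Group G] [Group Gbar] [Group.FG G]
    (G₁ H : Subgroup G) [G₁.FiniteIndex] (hH : H ≤ G₁)
    (φ : G₁ →* Gbar) (hφ : Function.Surjective φ)
    (K : Subgroup Gbar) (hHK : (H.subgroupOf G₁).map φ ≤ K) (hK : K.index = 0)
    (C : ComplexityClass) (hC : MembershipIn C K) :
    MembershipGenericallyIn C H ∧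
      ((∃ (k : ℕ) (b : Fin k → Gbar), Generates b ∧ ¬ SchreierAmenable K b) →
        (∀ (k : ℕ) (b : Fin k → Gbar), Generates b → ¬ SchreierAmenable K b) ∧
          MembershipStronglyGenericallyIn C H) := by
  have hinf : Infinite (G ⧸ preimage φ K) := infinite_quotient_preimage hφ hK
  have hinfbar : Infinite (Gbar ⧸ K) := by
    rw [Subgroup.index, Nat.card_eq_zero] at hK
    exact hK.resolve_left (not_isEmpty_of_nonempty _)
  have : Infinite G := Infinite.of_surjective _ (QuotientGroup.mk_surjective (s := preimage φ K))
  have : Infinite Gbar := Infinite.of_surjective _ (QuotientGroup.mk_surjective (s := K))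
  have : Fintype (G ⧸ G₁) := Fintype.ofFinite _
  have hcard : ∀ k : ℕ, ((Fintype.card (Fin k × Bool) : ℕ) : ℝ) = 2 * k := fun k => by
    simp [mul_comm]
  refine ⟨fun k a ha => ?_, ?_⟩
  · have hk := ha.pos_of_nontrivial
    obtain ⟨M, S, v, hmode, hcor, hdec, hS⟩ := exists_partial_algorithm hH hφ hHK hC ha
    refine ⟨M, hmode, hcor, S, generic_of_tendsto (by simp; omega) ?_, hdec⟩
    rw [hcard]
    have hlim := tendsto_finsetSum Finset.univ fun s (_ : s ∈ Finset.univ) =>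
      tendsto_wordCount_div hk ha (v s) ((1 : G) : G ⧸ preimage φ K)
    rw [Finset.sum_const_zero] at hlim
    refine squeeze_zero (fun n => by positivity) (fun n => ?_) hlim
    rw [← Finset.sum_div]
    gcongr
    exact_mod_cast (wordCount_mono hS n).trans (wordCount_iUnion_le _ n)
  · rintro ⟨m, b, hb, hna⟩
    have hgap := hasGap_of_not_schreierAmenable hb.pos_of_nontrivial hb hna
    refine ⟨fun k b' hb' => not_schreierAmenable_of_hasGap hb'.pos_of_nontrivial
      (hgap.of_generates hb'), fun k a ha => ?_⟩
    have hk := ha.pos_of_nontrivial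
    obtain ⟨M, S, v, hmode, hcor, hdec, hS⟩ := exists_partial_algorithm hH hφ hHK hC ha
    obtain ⟨σ, hσ0, hσ1, hσ⟩ := (hgap.preimage hφ ha).exists_decay hk
    -- The constant is the number of cosets of `G₁`, from a union bound over the starting points `v
    -- s`; `0 < k` supplies the two letters required.
    refine ⟨M, hmode, hcor, S, stronglyGeneric_of_le (by simp; omega) hσ0.le hσ1
      (C := Fintype.card (G ⧸ G₁)) (fun n => ?_), hdec⟩
    rw [hcard]
    calc (wordCount Sᶜ n : ℝ)
        ≤ ∑ s, (wordCount {w | wordVal a w • v s = ((1 : G) : G ⧸ preimage φ K)} n : ℝ) := by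
          exact_mod_cast (wordCount_mono hS n).trans (wordCount_iUnion_le _ n)
      _ ≤ ∑ _s : G ⧸ G₁, (σ * (2 * k)) ^ n := Finset.sum_le_sum fun s _ => by
          have := hσ n (v s) ((1 : G) : G ⧸ preimage φ K)
          rwa [walkOp_pow_single, div_le_iff₀ (by positivity), ← mul_pow] at this
      _ = _ := by simp
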